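/- Let $t,s_1,s_2,s_3,r_1,r_2\in\mathbb{C}$ with $t\ne 0,1$, $s_1\notin\{0,-1,-2,\dots\}$ and $r_1+r_2=s_1+s_2+s_3-1$. For a parameter $\lambda$ let $$D_x=x(x-1)(x-t)\frac{d^2}{dx^2}+x(x-1)(x-t)\Big(\frac{s_1}{x}+\frac{s_2}{x-1}+\frac{s_3}{x-t}\Big)\frac{d}{dx}+r_1r_2x+\lambda .$$ Let $f_\lambda(x)=\sum_{i\ge 0}P_i(\lambda)x^i$ be the unique power series solution of $D_xf_\lambda=0$ with $f_\lambda(0)=1$. Then $P_i$ is a polynomial of degree $i$ in $\lambda$, so $P_0,P_1,\dots$ is a basis of $\mathbb{C}[\lambda]$. Let $C_{i,j}^k\in\mathbb{C}$ be the structure constants given by $P_iP_j=\sum_k C_{i,j}^kP_k$, and let $$K(x_1,x_2,y)=\sum_{i,j,k\ge 0}C_{i,j}^k\frac{x_1^ix_2^j}{y^{k+1}},$$ a formal power series in $x_1,x_2$ whose coefficients are polynomials in $y^{-1}$. Let $F(a,b,c,u)=\sum_{n\ge 0}\frac{(a)_n(b)_n}{(c)_n}\frac{u^n}{n!}$ be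 the Gauss hypergeometric series, where $(a)_n=a(a+1)\cdots(a+n-1)$. Put $$D_y^*=\frac{d^2}{dy^2}\cdot y(y-1)(y-t)-\frac{d}{dy}\cdot y(y-1)(y-t)\Big(\frac{s_1}{y}+\frac{s_2}{y-1}+\frac{s_3}{y-t}\Big)+r_1r_2y+\lambda$$ and $$L=\frac{(x_1-1)(x_1-t)}{(x_1-x_2)(x_1-y)}\frac{d}{dx_1}+\frac{(x_2-1)(x_2-t)}{(x_2-x_1)(x_2-y)}\frac{d}{dx_2}+\frac{(y-1)(y-t)}{(y-x_1)(y-x_2)}\frac{d}{dy}$$ $$-\frac{(r_1+r_2-2)x_1x_2y+(s_2+1-r_1-r_2)x_1x_2-(s_1+s_2-2)tx_1x_2+(s_1-1)t(x_1+x_2-y)}{x_1x_2(x_1-y)(x_2-y)}.$$ Then, for every $\lambda\in\mathbb{C}$, $$D_{x_1}K-D_{x_2}K=0,$$ $$D_y^*K-D_{x_1}K=(r_1-1)(r_2-1)F\Big(r_1,r_2,s_1,\frac{x_1x_2}{t}\Big),$$ and, if $s_1\ne 1$, $$LK=\frac{(s_1-1)t}{x_1x_2(x_1-y)(x_2-y)}F\Big(r_1-1,r_2-1,s_1-1,\frac{x_1x_2}{t}\Big).$$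 The first two equations hold in $\mathbb{C}[y,y^{-1}][[x_1,x_2]]$, the third in the field of fractions of this ring. -/

import Mathlib

open scoped Polynomial LaurentPolynomial

noncomputable section

/-! ### The differential operator and its conjugate -/

/-- The coefficient `x (x - 1) (x - t) (s₁ / x + s₂ / (x - 1) + s₃ / (x - t))` of the first
derivative, multiplied out. -/
def heunQ {A : Type*} [CommRing A] [Algebra ℂ A] (t s₁ s₂ s₃ : ℂ) (x : A) : A :=
  s₁ • ((x - 1) * (x - algebraMap ℂ A t)) + s₂ • (x * (x - algebraMap ℂ A t)) +
    s₃ • (x * (x - 1))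

/-- The operator
`x (x-1) (x-t) d²/dx² + x (x-1) (x-t) (s₁/x + s₂/(x-1) + s₃/(x-t)) d/dx + r₁ r₂ x + lam`
applied to `u`, where `x` is an element of a `ℂ`-algebra and `δ` stands for `d/dx`. -/
def heunOp {A : Type*} [CommRing A] [Algebra ℂ A] (t s₁ s₂ s₃ r₁ r₂ lam : ℂ)
    (δ : A → A) (x u : A) : A :=
  x * (x - 1) * (x - algebraMap ℂ A t) * δ (δ u) + heunQ t s₁ s₂ s₃ x * δ u +
    ((r₁ * r₂) • x + algebraMap ℂ A lam) * u

/-- The conjugate operator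
`d²/dy² · y (y-1) (y-t) - d/dy · y (y-1) (y-t) (s₁/y + s₂/(y-1) + s₃/(y-t)) + r₁ r₂ y + lam`
applied to `u`, where `δ` stands for `d/dy`. -/
def heunConjOp {A : Type*} [CommRing A] [Algebra ℂ A] (t s₁ s₂ s₃ r₁ r₂ lam : ℂ)
    (δ : A → A) (y u : A) : A :=
  δ (δ (y * (y - 1) * (y - algebraMap ℂ A t) * u)) - δ (heunQ t s₁ s₂ s₃ y * u) +
    ((r₁ * r₂) • y + algebraMap ℂ A lam) * u

/-! ### The polynomials `P_i(λ)` -/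

/-- The coefficients `P_i(λ)` (the polynomial variable is `λ`) of the solution
`f_λ(x) = ∑ P_i(λ) x^i`, `f_λ(0) = 1`, of `D_x f_λ = 0`, written out by the recurrence that the
equation amounts to; see `heunPoly_spec`. -/
def heunPoly (t s₁ s₂ s₃ r₁ r₂ : ℂ) : ℕ → ℂ[X]
  | 0 => 1
  | 1 => Polynomial.C (-(t * s₁)⁻¹) * Polynomial.X
  | m + 2 =>
      Polynomial.C (-(t * (m + 2) * (m + 1 + s₁))⁻¹) *
        ((Polynomial.X - Polynomial.C
            ((1 + t) * ((m + 1) * m) + (s₁ * (1 + t) + s₂ * t + s₃) * (m + 1))) *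
            heunPoly t s₁ s₂ s₃ r₁ r₂ (m + 1) +
          Polynomial.C (m * (m - 1) + (s₁ + s₂ + s₃) * m + r₁ * r₂) *
            heunPoly t s₁ s₂ s₃ r₁ r₂ m)

theorem coeff_heunOp_zero (t s₁ s₂ s₃ r₁ r₂ lam : ℂ) (g : PowerSeries ℂ) :
    PowerSeries.coeff 0 (heunOp t s₁ s₂ s₃ r₁ r₂ lam (PowerSeries.derivative ℂ) PowerSeries.X g) =
      t * s₁ * PowerSeries.coeff 1 g + lam * PowerSeries.coeff 0 g := by
  have h : PowerSeries.constantCoeff (PowerSeries.derivative ℂ g) = PowerSeries.coeff 1 g := by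
    rw [← PowerSeries.coeff_zero_eq_constantCoeff_apply, PowerSeries.coeff_derivative]
    simp
  simp only [heunOp, heunQ, PowerSeries.coeff_zero_eq_constantCoeff_apply,
    PowerSeries.algebraMap_apply, Algebra.algebraMap_self, RingHom.id_apply,
    PowerSeries.smul_eq_C_mul, map_add, map_mul, map_sub, map_one, PowerSeries.constantCoeff_X,
    PowerSeries.constantCoeff_C, h]
  ring

theorem coeff_heunOp_succ (t s₁ s₂ s₃ r₁ r₂ lam : ℂ) (g : PowerSeries ℂ) (m : ℕ) :
    PowerSeries.coeff (m + 1)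
        (heunOp t s₁ s₂ s₃ r₁ r₂ lam (PowerSeries.derivative ℂ) PowerSeries.X g) =
      t * (m + 2) * (m + 1 + s₁) * PowerSeries.coeff (m + 2) g +
        (lam - ((1 + t) * ((m + 1) * m) + (s₁ * (1 + t) + s₂ * t + s₃) * (m + 1))) *
          PowerSeries.coeff (m + 1) g +
        (m * (m - 1) + (s₁ + s₂ + s₃) * m + r₁ * r₂) * PowerSeries.coeff m g := by
  have e : heunOp t s₁ s₂ s₃ r₁ r₂ lam (PowerSeries.derivative ℂ) PowerSeries.X g =
      PowerSeries.C t * (PowerSeries.X * PowerSeries.derivative ℂ (PowerSeries.derivative ℂ g)) - PowerSeries.C (1 + t) *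
        (PowerSeries.X * (PowerSeries.X * PowerSeries.derivative ℂ (PowerSeries.derivative ℂ g)))
      + PowerSeries.X * (PowerSeries.X * (PowerSeries.X * PowerSeries.derivative ℂ (PowerSeries.derivative ℂ g)))
      + PowerSeries.C (s₁ * t) * PowerSeries.derivative ℂ g
      - PowerSeries.C (s₁ * (1 + t) + s₂ * t + s₃) * (PowerSeries.X * PowerSeries.derivative ℂ g)
      + PowerSeries.C (s₁ + s₂ + s₃) * (PowerSeries.X * (PowerSeries.X * PowerSeries.derivative ℂ g))
      + PowerSeries.C (r₁ * r₂) * (PowerSeries.X * g) + PowerSeries.C lam * g := by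
    simp only [heunOp, heunQ, PowerSeries.algebraMap_apply, Algebra.algebraMap_self,
      RingHom.id_apply, PowerSeries.smul_eq_C_mul, map_add, map_mul, map_one]
    ring
  rw [e]
  generalize hα : s₁ * (1 + t) + s₂ * t + s₃ = α
  generalize hβ : s₁ + s₂ + s₃ = β
  generalize hγ : 1 + t = γ
  simp only [map_add, map_sub, PowerSeries.coeff_C_mul, PowerSeries.coeff_succ_X_mul,
    PowerSeries.coeff_derivative]
  rcases m with _ | _ | m
  · simp [PowerSeries.coeff_zero_X_mul]
    ring
  · simp only [PowerSeries.coeff_succ_X_mul, PowerSeries.coeff_zero_X_mul,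
      PowerSeries.coeff_derivative, zero_add]
    push_cast
    ring
  · simp only [PowerSeries.coeff_succ_X_mul, PowerSeries.coeff_derivative]
    push_cast
    ring

/-- For every complex `λ`, the power series `∑ P_i(λ) x^i` is the unique solution of
`D_x f = 0`, `f(0) = 1`. -/
theorem heunPoly_spec (t s₁ s₂ s₃ r₁ r₂ : ℂ) (ht : t ≠ 0) (hs : ∀ n : ℕ, s₁ ≠ -n) (lam : ℂ)
    (g : PowerSeries ℂ) :
    (PowerSeries.constantCoeff g = 1 ∧
      heunOp t s₁ s₂ s₃ r₁ r₂ lam (PowerSeries.derivative ℂ) PowerSeries.X g = 0) ↔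
    g = PowerSeries.mk fun i => (heunPoly t s₁ s₂ s₃ r₁ r₂ i).eval lam := by
  have hs0 : s₁ ≠ 0 := by simpa using hs 0
  have h2 : ∀ m : ℕ, (m + 2 : ℂ) ≠ 0 := fun m => by exact_mod_cast (m + 1).succ_ne_zero
  have hsm : ∀ m : ℕ, (m + 1 + s₁ : ℂ) ≠ 0 := fun m h => hs (m + 1) (by
    push_cast
    linear_combination h)
  constructor
  · rintro ⟨h0, h⟩
    have hz : PowerSeries.coeff 0 g = 1 := by
      rw [PowerSeries.coeff_zero_eq_constantCoeff_apply, h0]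
    have key : ∀ n, PowerSeries.coeff n g = (heunPoly t s₁ s₂ s₃ r₁ r₂ n).eval lam ∧
        PowerSeries.coeff (n + 1) g = (heunPoly t s₁ s₂ s₃ r₁ r₂ (n + 1)).eval lam := by
      intro n
      induction n with
      | zero =>
        have h1 := coeff_heunOp_zero t s₁ s₂ s₃ r₁ r₂ lam g
        rw [h, map_zero, hz] at h1
        refine ⟨by simp [hz, heunPoly], ?_⟩
        simp only [zero_add, heunPoly, Polynomial.eval_mul, Polynomial.eval_C, Polynomial.eval_X]
        field_simp
        linear_combination -h1
      | succ m ih =>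
        refine ⟨ih.2, ?_⟩
        have h1 := coeff_heunOp_succ t s₁ s₂ s₃ r₁ r₂ lam g m
        rw [h, map_zero, ih.1, ih.2] at h1
        have := h2 m
        have := hsm m
        rw [heunPoly]
        simp only [Polynomial.eval_mul, Polynomial.eval_C, Polynomial.eval_X, Polynomial.eval_add,
          Polynomial.eval_sub]
        field_simp
        linear_combination -h1
    ext n
    rw [PowerSeries.coeff_mk, (key n).1]
  · rintro rfl
    refine ⟨by simp [← PowerSeries.coeff_zero_eq_constantCoeff_apply, heunPoly], ?_⟩
    ext n
    rcases n with _ | m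
    · rw [coeff_heunOp_zero]
      simp only [PowerSeries.coeff_mk, heunPoly, Polynomial.eval_mul, Polynomial.eval_C,
        Polynomial.eval_X, Polynomial.eval_one, map_zero]
      field_simp
      ring
    · have := h2 m
      have := hsm m
      rw [coeff_heunOp_succ]
      simp only [PowerSeries.coeff_mk, map_zero]
      rw [heunPoly]
      simp only [Polynomial.eval_mul, Polynomial.eval_C, Polynomial.eval_X, Polynomial.eval_add,
        Polynomial.eval_sub]
      field_simp
      ring

theorem heunPoly_degree (t s₁ s₂ s₃ r₁ r₂ : ℂ) (ht : t ≠ 0) (hs : ∀ n : ℕ, s₁ ≠ -n) (i : ℕ) :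
    (heunPoly t s₁ s₂ s₃ r₁ r₂ i).degree = i := by
  have hs0 : s₁ ≠ 0 := by simpa using hs 0
  have key : ∀ n : ℕ, (heunPoly t s₁ s₂ s₃ r₁ r₂ n).degree = n ∧
      (heunPoly t s₁ s₂ s₃ r₁ r₂ (n + 1)).degree = (n + 1 : ℕ) := by
    intro n
    induction n with
    | zero =>
      refine ⟨by simp [heunPoly], ?_⟩
      rw [zero_add, heunPoly, Polynomial.degree_C_mul (by simp [ht, hs0]), Polynomial.degree_X]
      rfl
    | succ m ih =>
      refine ⟨ih.2, ?_⟩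
      have h2 : (m + 2 : ℂ) ≠ 0 := by exact_mod_cast (m + 1).succ_ne_zero
      have hsm : (m + 1 + s₁ : ℂ) ≠ 0 := fun h => hs (m + 1) (by
        push_cast
        linear_combination h)
      rw [heunPoly, Polynomial.degree_C_mul (by simp [ht, h2, hsm])]
      have e : ((Polynomial.X - Polynomial.C
            ((1 + t) * ((m + 1) * m) + (s₁ * (1 + t) + s₂ * t + s₃) * (m + 1))) *
            heunPoly t s₁ s₂ s₃ r₁ r₂ (m + 1)).degree = ((m + 1 + 1 : ℕ) : WithBot ℕ) := by
        rw [Polynomial.degree_mul, Polynomial.degree_X_sub_C, ih.2, ← Nat.cast_one, ← Nat.cast_add,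
          add_comm]
      rw [Polynomial.degree_add_eq_left_of_degree_lt, e]
      rw [e]
      rw [← Polynomial.smul_eq_C_mul]
      refine lt_of_le_of_lt (Polynomial.degree_smul_le _ _) ?_
      rw [ih.1]
      exact_mod_cast (by omega : m < m + 1 + 1)
  exact (key i).1

/-- The polynomials `P_i(λ)`, `i = 0, 1, …`, as a sequence of polynomials with `deg P_i = i`. -/
def heunSeq (t s₁ s₂ s₃ r₁ r₂ : ℂ) (ht : t ≠ 0) (hs : ∀ n : ℕ, s₁ ≠ -n) :
    Polynomial.Sequence ℂ where
  elems' := heunPoly t s₁ s₂ s₃ r₁ r₂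
  degree_eq' := heunPoly_degree t s₁ s₂ s₃ r₁ r₂ ht hs

/-! ### Structure constants and the kernel -/

/-- The structure constants `C_{i,j}^k` of multiplication in the basis `P_0, P_1, …` of `ℂ[λ]`:
`P_i P_j = ∑_k C_{i,j}^k P_k`. -/
def structConst (P : Polynomial.Sequence ℂ) (i j : ℕ) : ℕ →₀ ℂ :=
  (P.basis fun i => (Polynomial.leadingCoeff_ne_zero.mpr (P.ne_zero i)).isUnit).repr (P i * P j)

/-- The ring `ℂ[y, y⁻¹][[x₁, x₂]]`; the power series variables `x₁`, `x₂` have the indices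
`0`, `1`. -/
abbrev KerRing : Type := MvPowerSeries (Fin 2) ℂ[T;T⁻¹]

/-- The variable `x₁`. -/
def varX₁ : KerRing := MvPowerSeries.X 0

/-- The variable `x₂`. -/
def varX₂ : KerRing := MvPowerSeries.X 1

/-- The variable `y`. -/
def varY : KerRing := MvPowerSeries.C (LaurentPolynomial.T 1)

/-- The generating function `K(x₁, x₂, y) = ∑ C_{i,j}^k x₁^i x₂^j / y^(k+1)`. -/
def kernel (P : Polynomial.Sequence ℂ) : KerRing := fun m =>
  (structConst P (m 0) (m 1)).sum fun k c => LaurentPolynomial.C c * LaurentPolynomial.T (-(k + 1))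

/-- The derivative `d/derivX₁`. -/
def derivX₁ : KerRing → KerRing := MvPowerSeries.pderiv ℂ[T;T⁻¹] 0

/-- The derivative `d/derivX₂`. -/
def derivX₂ : KerRing → KerRing := MvPowerSeries.pderiv ℂ[T;T⁻¹] 1

/-- The derivative of a Laurent polynomial. -/
def laurentDeriv (f : ℂ[T;T⁻¹]) : ℂ[T;T⁻¹] :=
  f.coeff.sum fun n c => LaurentPolynomial.C (n * c) * LaurentPolynomial.T (n - 1)

/-- The derivative `d/dy`, taken in each coefficient. -/
def derivY (u : KerRing) : KerRing := fun m => laurentDeriv (u m)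

/-- The Gauss hypergeometric series `F(a, b, c, x₁ x₂ / t)`: the coefficient of `x₁^i x₂^j` is
`(a)_i (b)_i / ((c)_i i! t^i)` if `i = j` and `0` otherwise. -/
def hypF (a b c t : ℂ) : KerRing := fun m =>
  if m 0 = m 1 then LaurentPolynomial.C (ordinaryHypergeometricCoefficient a b c (m 0) / t ^ m 0)
  else 0

/-- The field of fractions of `ℂ[y, y⁻¹][[x₁, x₂]]`. -/
abbrev KerField : Type := FractionRing KerRing

/-- The inclusion of `ℂ[y, y⁻¹][[x₁, x₂]]` in its field of fractions. -/
abbrev toField : KerRing →+* KerField := algebraMap KerRing KerField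

/-- The first order operator `L`, applied to `u`. -/
def opL (t s₁ s₂ r₁ r₂ : ℂ) (u : KerRing) : KerField :=
  let a : KerField := toField varX₁
  let b : KerField := toField varX₂
  let y : KerField := toField varY
  let k : ℂ → KerField := fun c => toField (algebraMap ℂ KerRing c)
  (a - 1) * (a - k t) / ((a - b) * (a - y)) * toField (derivX₁ u) +
    (b - 1) * (b - k t) / ((b - a) * (b - y)) * toField (derivX₂ u) +
    (y - 1) * (y - k t) / ((y - a) * (y - b)) * toField (derivY u) -
    (k (r₁ + r₂ - 2) * (a * b * y) + k (s₂ + 1 - r₁ - r₂) * (a * b) -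
        k ((s₁ + s₂ - 2) * t) * (a * b) + k ((s₁ - 1) * t) * (a + b - y)) /
      (a * b * (a - y) * (b - y)) * toField u

end

/-! Let κ (`kappa`) be the linear map with P_k ↦ y^{-(k+1)}, so that the coefficient of x₁^i x₂^j in
K is κ(P_i P_j). The equation D_x f = 0 amounts to a three-term recurrence expressing λ P_k through
P_{k+1}, P_k, P_{k-1}. Hence D_{x₁} acts on K by multiplying P_i P_j by (lam - X) inside κ, and so
does D_{x₂}; this is the first equation (`coeff_heunOp_kernel`).

The operator D_y^* acts on the powers y^{-(k+1)} by the same recurrence, except that at k = 0, where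
there is no P_{-1}, a constant term (r₁-1)(r₂-1) is left over (`heunConjOp_T`, `heunConjOp_kappa`).
So the defect in the second equation is (r₁-1)(r₂-1) ε(P_i P_j), where ε takes the coefficient of
P_0. The P_i are orthogonal for ε, and the recurrence gives their norms, which are the coefficients
of the hypergeometric series (`epsilon_mul`).

For the third equation let M (`opM`) be L cleared of denominators, E = D_{x₁} - D_{x₂} and F = D_y^*
- D_{x₁}. There is an operator T (`opT`) such that T M lies in the left ideal generated by E and F
(`opT_opM`). As E K = 0 and F K is known, T(M K) is known. The hypergeometric equation shows that T
takes the same value on the expected answer (`opT_hypergeometric`). The difference w of the two is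
divisible by x₂, because K = 1/(y - x₁) at x₂ = 0, and T w = 0. On the lowest coefficient of a
multiple of x₂^n, T acts with indicial factor n(n + s₁ - 2), which is nonzero for n ≥ 1 by the
conditions on s₁. So w is divisible by every power of x₂ and vanishes (`opT_eq_zero_imp_dvd`). -/

noncomputable section

/-! ### Second order operators in two derivations -/

section Leibniz

variable {A : Type*} [CommRing A] [Algebra ℂ A]

/-- The operator `p₁ ∂₁² + q₁ ∂₁ - p₂ ∂₂² - q₂ ∂₂ + v`. -/
def diffOp (d₁ d₂ : Derivation ℂ A A) (p₁ q₁ p₂ q₂ v u : A) : A :=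
  p₁ * d₁ (d₁ u) + q₁ * d₁ u - p₂ * d₂ (d₂ u) - q₂ * d₂ u + v * u

/-- The second derivatives of a product produce the cross terms. The potential `v` is already
counted in the first summand, hence the `0` in the last one. -/
theorem diffOp_mul (d₁ d₂ : Derivation ℂ A A) (p₁ q₁ p₂ q₂ v m u : A) :
    diffOp d₁ d₂ p₁ q₁ p₂ q₂ v (m * u) = m * diffOp d₁ d₂ p₁ q₁ p₂ q₂ v u +
      2 * p₁ * d₁ m * d₁ u - 2 * p₂ * d₂ m * d₂ u + diffOp d₁ d₂ p₁ q₁ p₂ q₂ 0 m * u := by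
  simp only [diffOp, Derivation.leibniz, map_add, smul_eq_mul]
  ring

theorem diffOp_add (d₁ d₂ : Derivation ℂ A A) (p₁ q₁ p₂ q₂ v u w : A) :
    diffOp d₁ d₂ p₁ q₁ p₂ q₂ v (u + w) =
      diffOp d₁ d₂ p₁ q₁ p₂ q₂ v u + diffOp d₁ d₂ p₁ q₁ p₂ q₂ v w := by
  simp only [diffOp, map_add]
  ring

theorem diffOp_comm (d₁ d₂ d : Derivation ℂ A A) (h₁ : ∀ u, d₁ (d u) = d (d₁ u))
    (h₂ : ∀ u, d₂ (d u) = d (d₂ u)) (p₁ q₁ p₂ q₂ v u : A) :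
    diffOp d₁ d₂ p₁ q₁ p₂ q₂ v (d u) = d (diffOp d₁ d₂ p₁ q₁ p₂ q₂ v u) -
      (d p₁ * d₁ (d₁ u) + d q₁ * d₁ u - d p₂ * d₂ (d₂ u) - d q₂ * d₂ u + d v * u) := by
  simp only [diffOp, Derivation.leibniz, map_add, map_sub, smul_eq_mul, h₁, h₂]
  ring

end Leibniz

/-! ### Coefficients of the equation for L, and the polynomial identities behind it -/

section Operators

variable {A : Type*} [CommRing A]

/-- The cubic `x (x - 1) (x - t)`. -/
def cubic (t x : A) : A := x * (x - 1) * (x - t)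

/-- The coefficient of the first derivative, with `s₃ = S + 1 - s₁ - s₂`. -/
def quadr (t a b S x : A) : A :=
  a * ((x - 1) * (x - t)) + b * (x * (x - t)) + (S + 1 - a - b) * (x * (x - 1))

/-- The numerator of the zeroth order term of `L`. -/
def numer (t a b S x y z : A) : A :=
  (S - 2) * (x * y * z) + (b + 1 - S) * (x * y) - (a + b - 2) * t * (x * y) +
    (a - 1) * t * (x + y - z)

/-- The coefficients of `L` multiplied by `x y (x - y) (x - z) (y - z)`. -/
def vecX (t x y z : A) : A := x * y * ((x - 1) * (x - t) * (y - z))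
def vecY (t x y z : A) : A := -(x * y * ((y - 1) * (y - t) * (x - z)))
def vecZ (t x y z : A) : A := x * y * ((z - 1) * (z - t) * (x - y))
def vecO (t a b S x y z : A) : A := -((x - y) * numer t a b S x y z)

/-- The common denominator of the equation satisfied by `L u`. -/
def vdm (x y z : A) : A := (x - y) * (z - x) * (z - y)
/-- The first order terms of the equation satisfied by the cleared operator. -/
def alphaX (t x y z : A) : A :=
  -((x - y) * z * ((x - 1) * (x - t)) * (z - y)) +
    2 * (z - x) * (z - y) * ((x - y) * ((x - 1) * (x - t)) + cubic t x)
def alphaY (t x y z : A) : A :=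
  (x - y) * z * ((y - 1) * (y - t)) * (z - x) +
    2 * (z - x) * (z - y) * (cubic t y - (x - y) * ((y - 1) * (y - t)))
def alphaZ (t x y z : A) : A := -((x - y) * (x - y) * cubic t z)

/-- The zeroth order term of the equation. -/
def gammaO (t a b S x y z : A) : A :=
  let c := 2 + b - S + 3 * t - t * a - t * b
  let e := c + 1 + t
  (2 * t * a - 4 * t) * z ^ 2 + (5 * t - 2 * t * a) * ((x + y) * z) + c * ((x + y) * z ^ 2)
    - e * ((x ^ 2 + y ^ 2) * z) + (2 * S - 3) * ((x ^ 2 + y ^ 2) * z ^ 2)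
    + (4 - 2 * S) * ((x ^ 3 + y ^ 3) * z)
    + (2 * t * a - 6 * t) * (x * y) - 2 * c * (x * y * z) - 2 * S * (x * y * z ^ 2)
    + e * (x * y * (x + y)) + 3 * (x * y * (x + y) * z)
    - (4 - 2 * S) * (x * y * (x ^ 2 + y ^ 2)) - 2 * S * (x ^ 2 * y ^ 2)

/-- The coefficient of `D_x - D_y` in the equation, up to `vdm * vecO`. -/
def epsO (t x y z : A) : A :=
  x * y * (2 * t * z ^ 3 - 3 * t * ((x + y) * z ^ 2) - (1 + t) * ((x + y) * z ^ 3) +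
    (2 + 2 * t) * ((x ^ 2 + x * y + y ^ 2) * z ^ 2) - y ^ 3 * z ^ 2 + 6 * t * (x * y * z) +
    2 * (x * y * z ^ 3) - (4 + 4 * t) * (x * y ^ 2 * z) - x * y ^ 2 * z ^ 2 + 2 * (x * y ^ 3 * z) -
    3 * t * (x ^ 2 * y) - (1 + t) * (x ^ 2 * y * z) - 4 * (x ^ 2 * y * z ^ 2) +
    (2 + 2 * t) * (x ^ 2 * y ^ 2) + 2 * (x ^ 2 * y ^ 2 * z) - x ^ 2 * y ^ 3 + t * x ^ 3 -
    (1 + t) * (x ^ 3 * z) + 2 * (x ^ 3 * y * z) - x ^ 3 * y ^ 2)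

/-- The coefficient of `D_z^* - D_x` in the equation. -/
def zeta (t x y z : A) : A := x * y * (x - y) ^ 3 * ((z - 1) * (z - t))

end Operators

section Symbol

set_option linter.unusedSimpArgs false

variable {B : Type*} [CommRing B] (t a b S r x y z : B)

/-- This and the nine identities that follow are the coefficients of the derivatives of `u` (second,
first and zeroth order) in `opT_opM`, once all derivatives of the coefficient polynomials are
written out. Separating them keeps each call of `ring` small. -/
theorem symbol_xx :
    vdm x y z * (2 * cubic t x * (y * (3 * x ^ 2 - 2 * (1 + t) * x + t) * (y - z)) - vecX t x
      y z * (3 * x ^ 2 - 2 * (1 + t) * x + t)) - alphaX t x y z * vecX t x y z - epsO t x y z *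
      cubic t x + zeta t x y z * cubic t x = 0 := by
  simp only [vdm, alphaX, alphaY, alphaZ, gammaO, epsO, zeta, vecX, vecY, vecZ, vecO, numer, cubic,
    quadr]
  ring

theorem symbol_yy :
    vdm x y z * (vecY t x y z * (3 * y ^ 2 - 2 * (1 + t) * y + t) - 2 * cubic t y * (-(x * (3
      * y ^ 2 - 2 * (1 + t) * y + t) * (x - z)))) - alphaY t x y z * vecY t x y z + epsO t x y z
      * cubic t y = 0 := by
  simp only [vdm, alphaX, alphaY, alphaZ, gammaO, epsO, zeta, vecX, vecY, vecZ, vecO, numer, cubic,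
    quadr]
  ring

theorem symbol_xy :
    vdm x y z * (2 * cubic t x * (-(cubic t y * (2 * x - z))) - 2 * cubic t y * (cubic t x *
      (2 * y - z))) - alphaX t x y z * vecY t x y z - alphaY t x y z * vecX t x y z = 0 := by
  simp only [vdm, alphaX, alphaY, alphaZ, gammaO, epsO, zeta, vecX, vecY, vecZ, vecO, numer, cubic,
    quadr]
  ring

theorem symbol_xz :
    vdm x y z * (2 * cubic t x * (y * (2 * x - y) * ((z - 1) * (z - t)))) - alphaX t x y z *
      vecZ t x y z - alphaZ t x y z * vecX t x y z = 0 := by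
  simp only [vdm, alphaX, alphaY, alphaZ, gammaO, epsO, zeta, vecX, vecY, vecZ, vecO, numer, cubic,
    quadr]
  ring

theorem symbol_yz :
    -(vdm x y z * (2 * cubic t y * (x * (x - 2 * y) * ((z - 1) * (z - t))))) - alphaY t x y z
      * vecZ t x y z - alphaZ t x y z * vecY t x y z = 0 := by
  simp only [vdm, alphaX, alphaY, alphaZ, gammaO, epsO, zeta, vecX, vecY, vecZ, vecO, numer, cubic,
    quadr]
  ring

theorem symbol_zz :
    -(alphaZ t x y z * vecZ t x y z) - zeta t x y z * cubic t z = 0 := by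
  simp only [vdm, alphaX, alphaY, alphaZ, gammaO, epsO, zeta, vecX, vecY, vecZ, vecO, numer, cubic,
    quadr]
  ring

theorem symbol_x :
    vdm x y z * (2 * cubic t x * (-numer t a b S x y z - (x - y) * ((S - 2) * (y * z) + (b + 1
      - S) * y - (a + b - 2) * t * y + (a - 1) * t)) - vecX t x y z * (2 * (S + 1) * x - a * (1
      + t) - b * t - (S + 1 - a - b)) + cubic t x * (y * (6 * x - 2 * (1 + t)) * (y - z)) +
      quadr t a b S x * (y * (3 * x ^ 2 - 2 * (1 + t) * x + t) * (y - z)) - cubic t y * (2 *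
      cubic t x) - quadr t a b S y * (cubic t x * (2 * y - z))) - alphaX t x y z * ((y * (3 * x
      ^ 2 - 2 * (1 + t) * x + t) * (y - z)) + vecO t a b S x y z) - alphaY t x y z * (cubic t x
      * (2 * y - z)) - alphaZ t x y z * (-(y * cubic t x)) - gammaO t a b S x y z * vecX t x y z
      - epsO t x y z * quadr t a b S x + zeta t x y z * quadr t a b S x = 0 := by
  simp only [vdm, alphaX, alphaY, alphaZ, gammaO, epsO, zeta, vecX, vecY, vecZ, vecO, numer, cubic,
    quadr]
  ring

theorem symbol_y :
    vdm x y z * (vecY t x y z * (2 * (S + 1) * y - a * (1 + t) - b * t - (S + 1 - a - b)) - 2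
      * cubic t y * (numer t a b S x y z - (x - y) * ((S - 2) * (x * z) + (b + 1 - S) * x - (a +
      b - 2) * t * x + (a - 1) * t)) + cubic t x * (-(2 * cubic t y)) + quadr t a b S x *
      (-(cubic t y * (2 * x - z))) - cubic t y * (-(x * (6 * y - 2 * (1 + t)) * (x - z))) -
      quadr t a b S y * (-(x * (3 * y ^ 2 - 2 * (1 + t) * y + t) * (x - z)))) - alphaX t x y z *
      (-(cubic t y * (2 * x - z))) - alphaY t x y z * ((-(x * (3 * y ^ 2 - 2 * (1 + t) * y + t)
      * (x - z))) + vecO t a b S x y z) - alphaZ t x y z * (x * cubic t y) - gammaO t a b S x y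
      z * vecY t x y z + epsO t x y z * quadr t a b S y = 0 := by
  simp only [vdm, alphaX, alphaY, alphaZ, gammaO, epsO, zeta, vecX, vecY, vecZ, vecO, numer, cubic,
    quadr]
  ring

theorem symbol_z :
    vdm x y z * (cubic t x * (2 * y * ((z - 1) * (z - t))) + quadr t a b S x * (y * (2 * x -
      y) * ((z - 1) * (z - t))) - cubic t y * (-(2 * x * ((z - 1) * (z - t)))) - quadr t a b S y
      * (x * (x - 2 * y) * ((z - 1) * (z - t)))) - alphaX t x y z * (y * (2 * x - y) * ((z - 1)
      * (z - t))) - alphaY t x y z * (x * (x - 2 * y) * ((z - 1) * (z - t))) - alphaZ t x y z *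
      ((x * y * (x - y) * (2 * z - 1 - t)) + vecO t a b S x y z) - gammaO t a b S x y z * vecZ t
      x y z - zeta t x y z * (2 * (3 * z ^ 2 - 2 * (1 + t) * z + t) - quadr t a b S z) = 0 := by
  simp only [vdm, alphaX, alphaY, alphaZ, gammaO, epsO, zeta, vecX, vecY, vecZ, vecO, numer, cubic,
    quadr]
  ring

theorem symbol_one :
    vdm x y z * (r * vecY t x y z - r * vecX t x y z + cubic t x * (-(2 * ((S - 2) * (y * z) +
      (b + 1 - S) * y - (a + b - 2) * t * y + (a - 1) * t))) + quadr t a b S x * (-numer t a b S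
      x y z - (x - y) * ((S - 2) * (y * z) + (b + 1 - S) * y - (a + b - 2) * t * y + (a - 1) *
      t)) - cubic t y * (2 * ((S - 2) * (x * z) + (b + 1 - S) * x - (a + b - 2) * t * x + (a -
      1) * t)) - quadr t a b S y * (numer t a b S x y z - (x - y) * ((S - 2) * (x * z) + (b + 1
      - S) * x - (a + b - 2) * t * x + (a - 1) * t))) - alphaX t x y z * (-numer t a b S x y z -
      (x - y) * ((S - 2) * (y * z) + (b + 1 - S) * y - (a + b - 2) * t * y + (a - 1) * t)) -
      alphaY t x y z * (numer t a b S x y z - (x - y) * ((S - 2) * (x * z) + (b + 1 - S) * x -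
      (a + b - 2) * t * x + (a - 1) * t)) - alphaZ t x y z * (-((x - y) * ((S - 2) * (x * y) -
      (a - 1) * t))) - gammaO t a b S x y z * vecO t a b S x y z - epsO t x y z * (r * (x - y))
      - zeta t x y z * (6 * z - 2 * (1 + t) - 2 * (S + 1) * z + a * (1 + t) + b * t + (S + 1 - a
      - b) + r * z - r * x) = 0 := by
  simp only [vdm, alphaX, alphaY, alphaZ, gammaO, epsO, zeta, vecX, vecY, vecZ, vecO, numer, cubic,
    quadr]
  ring

end Symbol

/-! ### The operators E, F, M, T for three commuting derivations; x, y, z stand for x₁, x₂, y -/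

/-- Three commuting derivations with their coordinates. -/
structure CoordDeriv (A : Type*) [CommRing A] [Algebra ℂ A] where
  d₁ : Derivation ℂ A A
  d₂ : Derivation ℂ A A
  d₃ : Derivation ℂ A A
  x : A
  y : A
  z : A
  comm₂₁ (u : A) : d₂ (d₁ u) = d₁ (d₂ u)
  comm₃₁ (u : A) : d₃ (d₁ u) = d₁ (d₃ u)
  comm₃₂ (u : A) : d₃ (d₂ u) = d₂ (d₃ u)
  d₁x : d₁ x = 1
  d₁y : d₁ y = 0
  d₁z : d₁ z = 0
  d₂x : d₂ x = 0
  d₂y : d₂ y = 1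
  d₂z : d₂ z = 0
  d₃x : d₃ x = 0
  d₃y : d₃ y = 0
  d₃z : d₃ z = 1

namespace CoordDeriv

variable {A : Type*} [CommRing A] [Algebra ℂ A] (c : CoordDeriv A) (t a b S r : ℂ)

local notation "t'" => algebraMap ℂ A t
local notation "a'" => algebraMap ℂ A a
local notation "b'" => algebraMap ℂ A b
local notation "S'" => algebraMap ℂ A S
local notation "r'" => algebraMap ℂ A r

/-- `D_x - D_y`. -/
def opE (u : A) : A :=
  diffOp c.d₁ c.d₂ (cubic t' c.x) (quadr t' a' b' S' c.x) (cubic t' c.y) (quadr t' a' b' S' c.y)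
    (r' * (c.x - c.y)) u

/-- `D_z^* - D_x`. -/
def opF (u : A) : A :=
  c.d₃ (c.d₃ (cubic t' c.z * u)) - c.d₃ (quadr t' a' b' S' c.z * u) + r' * c.z * u -
    (cubic t' c.x * c.d₁ (c.d₁ u) + quadr t' a' b' S' c.x * c.d₁ u + r' * c.x * u)

/-- The operator `L`, cleared of denominators. -/
def opM (u : A) : A :=
  vecX t' c.x c.y c.z * c.d₁ u + vecY t' c.x c.y c.z * c.d₂ u + vecZ t' c.x c.y c.z * c.d₃ u +
    vecO t' a' b' S' c.x c.y c.z * u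

/-- An operator that annihilates `opM u` whenever `opE u = 0` and `opF u = 0`. -/
def opT (u : A) : A :=
  vdm c.x c.y c.z * c.opE t a b S r u - alphaX t' c.x c.y c.z * c.d₁ u -
    alphaY t' c.x c.y c.z * c.d₂ u - alphaZ t' c.x c.y c.z * c.d₃ u -
    gammaO t' a' b' S' c.x c.y c.z * u

/-- The commutator of D_x - D_y with ∂_x only sees the coefficients that depend on x, so it is minus
the operator whose coefficients are their x-derivatives. -/
theorem opE_d₁ (u : A) : c.opE t a b S r (c.d₁ u) = c.d₁ (c.opE t a b S r u) -
    ((3 * c.x ^ 2 - 2 * (1 + t') * c.x + t') * c.d₁ (c.d₁ u) +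
      (2 * (S' + 1) * c.x - a' * (1 + t') - b' * t' - (S' + 1 - a' - b')) * c.d₁ u + r' * u) := by
  rw [opE, diffOp_comm c.d₁ c.d₂ c.d₁ (fun _ => rfl) c.comm₂₁]
  simp only [opE, cubic, quadr, Derivation.leibniz, map_add, map_sub, Derivation.map_one_eq_zero,
    Derivation.map_algebraMap, c.d₁x, c.d₁y, smul_eq_mul]
  ring

theorem opE_d₂ (u : A) : c.opE t a b S r (c.d₂ u) = c.d₂ (c.opE t a b S r u) +
    ((3 * c.y ^ 2 - 2 * (1 + t') * c.y + t') * c.d₂ (c.d₂ u) +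
      (2 * (S' + 1) * c.y - a' * (1 + t') - b' * t' - (S' + 1 - a' - b')) * c.d₂ u + r' * u) := by
  rw [opE, diffOp_comm c.d₁ c.d₂ c.d₂ (fun u => (c.comm₂₁ u).symm) (fun _ => rfl)]
  simp only [opE, cubic, quadr, Derivation.leibniz, map_add, map_sub, Derivation.map_one_eq_zero,
    Derivation.map_algebraMap, c.d₂x, c.d₂y, smul_eq_mul]
  ring

theorem opE_d₃ (u : A) : c.opE t a b S r (c.d₃ u) = c.d₃ (c.opE t a b S r u) := by
  rw [opE, diffOp_comm c.d₁ c.d₂ c.d₃ (fun u => (c.comm₃₁ u).symm) (fun u => (c.comm₃₂ u).symm)]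
  simp only [opE, cubic, quadr, Derivation.leibniz, map_add, map_sub, Derivation.map_one_eq_zero,
    Derivation.map_algebraMap, c.d₃x, c.d₃y, smul_eq_mul]
  ring

/-- Normal form with all coefficients to the left of the derivatives, needed to compare coefficients
in `opT_opM`. -/
theorem opF_eq (u : A) : c.opF t a b S r u = cubic t' c.z * c.d₃ (c.d₃ u) +
    (2 * (3 * c.z ^ 2 - 2 * (1 + t') * c.z + t') - quadr t' a' b' S' c.z) * c.d₃ u +
    (6 * c.z - 2 * (1 + t') - 2 * (S' + 1) * c.z + a' * (1 + t') + b' * t' + (S' + 1 - a' - b') +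
      r' * c.z) * u -
    (cubic t' c.x * c.d₁ (c.d₁ u) + quadr t' a' b' S' c.x * c.d₁ u + r' * c.x * u) := by
  simp only [opF, cubic, quadr, Derivation.leibniz, map_add, map_sub, Derivation.map_one_eq_zero,
    Derivation.map_algebraMap, c.d₃z, smul_eq_mul, map_zero]
  ring

section Coefficients

theorem d_vecX : c.d₁ (vecX t' c.x c.y c.z) =
    c.y * (3 * c.x ^ 2 - 2 * (1 + t') * c.x + t') * (c.y - c.z) ∧
    c.d₂ (vecX t' c.x c.y c.z) = cubic t' c.x * (2 * c.y - c.z) ∧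
    c.d₃ (vecX t' c.x c.y c.z) = - (c.y * cubic t' c.x) := by
  refine ⟨?_, ?_, ?_⟩ <;>
  · simp only [vecX, cubic, Derivation.leibniz, map_sub, Derivation.map_one_eq_zero,
      Derivation.map_algebraMap, c.d₁x, c.d₁y, c.d₁z, c.d₂x, c.d₂y, c.d₂z, c.d₃x, c.d₃y, c.d₃z,
      smul_eq_mul]
    ring

theorem d_vecY : c.d₁ (vecY t' c.x c.y c.z) = -(cubic t' c.y * (2 * c.x - c.z)) ∧
    c.d₂ (vecY t' c.x c.y c.z) =
      -(c.x * (3 * c.y ^ 2 - 2 * (1 + t') * c.y + t') * (c.x - c.z)) ∧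
    c.d₃ (vecY t' c.x c.y c.z) = c.x * cubic t' c.y := by
  refine ⟨?_, ?_, ?_⟩ <;>
  · simp only [vecY, cubic, Derivation.leibniz, map_sub, map_neg,
      Derivation.map_one_eq_zero,
      Derivation.map_algebraMap, c.d₁x, c.d₁y, c.d₁z, c.d₂x, c.d₂y, c.d₂z, c.d₃x, c.d₃y, c.d₃z,
      smul_eq_mul]
    ring

theorem d_vecZ : c.d₁ (vecZ t' c.x c.y c.z) =
      c.y * (2 * c.x - c.y) * ((c.z - 1) * (c.z - t')) ∧
    c.d₂ (vecZ t' c.x c.y c.z) = c.x * (c.x - 2 * c.y) * ((c.z - 1) * (c.z - t')) ∧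
    c.d₃ (vecZ t' c.x c.y c.z) = c.x * c.y * (c.x - c.y) * (2 * c.z - 1 - t') := by
  refine ⟨?_, ?_, ?_⟩ <;>
  · simp only [vecZ, Derivation.leibniz, map_sub,
      Derivation.map_one_eq_zero,
      Derivation.map_algebraMap, c.d₁x, c.d₁y, c.d₁z, c.d₂x, c.d₂y, c.d₂z, c.d₃x, c.d₃y, c.d₃z,
      smul_eq_mul]
    ring

theorem d_numer : c.d₁ (numer t' a' b' S' c.x c.y c.z) =
      (S' - 2) * (c.y * c.z) + (b' + 1 - S') * c.y - (a' + b' - 2) * t' * c.y + (a' - 1) * t' ∧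
    c.d₂ (numer t' a' b' S' c.x c.y c.z) =
      (S' - 2) * (c.x * c.z) + (b' + 1 - S') * c.x - (a' + b' - 2) * t' * c.x + (a' - 1) * t' ∧
    c.d₃ (numer t' a' b' S' c.x c.y c.z) = (S' - 2) * (c.x * c.y) - (a' - 1) * t' := by
  have h2 (d : Derivation ℂ A A) : d (2 : A) = 0 := by exact_mod_cast d.map_natCast 2
  refine ⟨?_, ?_, ?_⟩ <;>
  · simp only [numer, Derivation.leibniz, map_add, map_sub, h2,
      Derivation.map_one_eq_zero,
      Derivation.map_algebraMap, c.d₁x, c.d₁y, c.d₁z, c.d₂x, c.d₂y, c.d₂z, c.d₃x, c.d₃y, c.d₃z,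
      smul_eq_mul]
    ring

end Coefficients

section Coefficients

theorem dd_vecX : c.d₁ (c.d₁ (vecX t' c.x c.y c.z)) =
      c.y * (6 * c.x - 2 * (1 + t')) * (c.y - c.z) ∧
    c.d₂ (c.d₂ (vecX t' c.x c.y c.z)) = 2 * cubic t' c.x := by
  have h2 (d : Derivation ℂ A A) : d (2 : A) = 0 := by exact_mod_cast d.map_natCast 2
  have h3 (d : Derivation ℂ A A) : d (3 : A) = 0 := by exact_mod_cast d.map_natCast 3
  refine ⟨?_, ?_⟩ <;>
  · simp only [(c.d_vecX t).1, (c.d_vecX t).2.1, pow_two, cubic, Derivation.leibniz, map_add,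
      map_sub, Derivation.map_one_eq_zero, h2, h3,
      Derivation.map_algebraMap, c.d₁x, c.d₁y, c.d₁z, c.d₂x, c.d₂y, c.d₂z, smul_eq_mul]
    ring

theorem dd_vecY : c.d₁ (c.d₁ (vecY t' c.x c.y c.z)) = -(2 * cubic t' c.y) ∧
    c.d₂ (c.d₂ (vecY t' c.x c.y c.z)) =
      -(c.x * (6 * c.y - 2 * (1 + t')) * (c.x - c.z)) := by
  have h2 (d : Derivation ℂ A A) : d (2 : A) = 0 := by exact_mod_cast d.map_natCast 2
  have h3 (d : Derivation ℂ A A) : d (3 : A) = 0 := by exact_mod_cast d.map_natCast 3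
  refine ⟨?_, ?_⟩ <;>
  · simp only [(c.d_vecY t).1, (c.d_vecY t).2.1, pow_two, cubic, Derivation.leibniz, map_add,
      map_sub, map_neg, Derivation.map_one_eq_zero, h2, h3,
      Derivation.map_algebraMap, c.d₁x, c.d₁y, c.d₁z, c.d₂x, c.d₂y, c.d₂z, smul_eq_mul]
    ring

theorem dd_vecZ : c.d₁ (c.d₁ (vecZ t' c.x c.y c.z)) = 2 * c.y * ((c.z - 1) * (c.z - t')) ∧
    c.d₂ (c.d₂ (vecZ t' c.x c.y c.z)) = -(2 * c.x * ((c.z - 1) * (c.z - t'))) := by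
  have h2 (d : Derivation ℂ A A) : d (2 : A) = 0 := by exact_mod_cast d.map_natCast 2
  refine ⟨?_, ?_⟩ <;>
  · simp only [(c.d_vecZ t).1, (c.d_vecZ t).2.1, Derivation.leibniz, map_sub,
      Derivation.map_one_eq_zero, h2,
      Derivation.map_algebraMap, c.d₁x, c.d₁y, c.d₁z, c.d₂x, c.d₂y, c.d₂z, smul_eq_mul]
    ring

theorem d_vecO :
    c.d₁ (vecO t' a' b' S' c.x c.y c.z) = -numer t' a' b' S' c.x c.y c.z - (c.x - c.y) *
      ((S' - 2) * (c.y * c.z) + (b' + 1 - S') * c.y - (a' + b' - 2) * t' * c.y + (a' - 1) * t') ∧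
    c.d₂ (vecO t' a' b' S' c.x c.y c.z) = numer t' a' b' S' c.x c.y c.z - (c.x - c.y) *
      ((S' - 2) * (c.x * c.z) + (b' + 1 - S') * c.x - (a' + b' - 2) * t' * c.x + (a' - 1) * t') ∧
    c.d₃ (vecO t' a' b' S' c.x c.y c.z) =
      -((c.x - c.y) * ((S' - 2) * (c.x * c.y) - (a' - 1) * t')) := by
  refine ⟨?_, ?_, ?_⟩ <;>
  · simp only [vecO, map_neg, Derivation.leibniz, map_sub, (c.d_numer t a b S).1,
      (c.d_numer t a b S).2.1, (c.d_numer t a b S).2.2, c.d₁x, c.d₁y, c.d₂x, c.d₂y, c.d₃x, c.d₃y,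
      smul_eq_mul]
    ring

theorem dd_vecO :
    c.d₁ (c.d₁ (vecO t' a' b' S' c.x c.y c.z)) = -(2 *
      ((S' - 2) * (c.y * c.z) + (b' + 1 - S') * c.y - (a' + b' - 2) * t' * c.y + (a' - 1) * t')) ∧
    c.d₂ (c.d₂ (vecO t' a' b' S' c.x c.y c.z)) = 2 *
      ((S' - 2) * (c.x * c.z) + (b' + 1 - S') * c.x - (a' + b' - 2) * t' * c.x + (a' - 1) * t') := by
  have h2 (d : Derivation ℂ A A) : d (2 : A) = 0 := by exact_mod_cast d.map_natCast 2
  refine ⟨?_, ?_⟩ <;>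
  · simp only [(c.d_vecO t a b S).1, (c.d_vecO t a b S).2.1, map_neg, Derivation.leibniz, map_sub,
      map_add, (c.d_numer t a b S).1, (c.d_numer t a b S).2.1, c.d₁x, c.d₁y, c.d₁z, c.d₂x, c.d₂y,
      c.d₂z, Derivation.map_one_eq_zero, Derivation.map_algebraMap, h2, smul_eq_mul]
    ring

end Coefficients

set_option maxHeartbeats 1000000 in
-- Moving `opE` past the first order operator `opM` leaves commutator terms of order at most two.
-- After multiplication by `vdm`, these are matched by the first order part of `opT` composed with
-- `opM`, modulo multiples of `opE u` and `opF u`. The polynomials `alphaX`, …, `zeta` are such that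
-- all ten coefficients agree.
theorem opT_opM (u : A) : c.opT t a b S r (c.opM t a b S u) =
    vdm c.x c.y c.z * (vecX t' c.x c.y c.z * c.d₁ (c.opE t a b S r u) +
      vecY t' c.x c.y c.z * c.d₂ (c.opE t a b S r u) +
      vecZ t' c.x c.y c.z * c.d₃ (c.opE t a b S r u)) +
    (vdm c.x c.y c.z * vecO t' a' b' S' c.x c.y c.z + epsO t' c.x c.y c.z) * c.opE t a b S r u +
    zeta t' c.x c.y c.z * c.opF t a b S r u := by
  have hE : c.opE t a b S r (c.opM t a b S u) =
      vecX t' c.x c.y c.z * c.opE t a b S r (c.d₁ u) +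
      vecY t' c.x c.y c.z * c.opE t a b S r (c.d₂ u) +
      vecZ t' c.x c.y c.z * c.opE t a b S r (c.d₃ u) +
      vecO t' a' b' S' c.x c.y c.z * c.opE t a b S r u +
      2 * cubic t' c.x * (c.d₁ (vecX t' c.x c.y c.z) * c.d₁ (c.d₁ u) +
        c.d₁ (vecY t' c.x c.y c.z) * c.d₁ (c.d₂ u) + c.d₁ (vecZ t' c.x c.y c.z) * c.d₁ (c.d₃ u) +
        c.d₁ (vecO t' a' b' S' c.x c.y c.z) * c.d₁ u) -
      2 * cubic t' c.y * (c.d₂ (vecX t' c.x c.y c.z) * c.d₁ (c.d₂ u) +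
        c.d₂ (vecY t' c.x c.y c.z) * c.d₂ (c.d₂ u) + c.d₂ (vecZ t' c.x c.y c.z) * c.d₂ (c.d₃ u) +
        c.d₂ (vecO t' a' b' S' c.x c.y c.z) * c.d₂ u) +
      (cubic t' c.x * c.d₁ (c.d₁ (vecX t' c.x c.y c.z)) +
        quadr t' a' b' S' c.x * c.d₁ (vecX t' c.x c.y c.z) -
        cubic t' c.y * c.d₂ (c.d₂ (vecX t' c.x c.y c.z)) -
        quadr t' a' b' S' c.y * c.d₂ (vecX t' c.x c.y c.z)) * c.d₁ u +
      (cubic t' c.x * c.d₁ (c.d₁ (vecY t' c.x c.y c.z)) +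
        quadr t' a' b' S' c.x * c.d₁ (vecY t' c.x c.y c.z) -
        cubic t' c.y * c.d₂ (c.d₂ (vecY t' c.x c.y c.z)) -
        quadr t' a' b' S' c.y * c.d₂ (vecY t' c.x c.y c.z)) * c.d₂ u +
      (cubic t' c.x * c.d₁ (c.d₁ (vecZ t' c.x c.y c.z)) +
        quadr t' a' b' S' c.x * c.d₁ (vecZ t' c.x c.y c.z) -
        cubic t' c.y * c.d₂ (c.d₂ (vecZ t' c.x c.y c.z)) -
        quadr t' a' b' S' c.y * c.d₂ (vecZ t' c.x c.y c.z)) * c.d₃ u +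
      (cubic t' c.x * c.d₁ (c.d₁ (vecO t' a' b' S' c.x c.y c.z)) +
        quadr t' a' b' S' c.x * c.d₁ (vecO t' a' b' S' c.x c.y c.z) -
        cubic t' c.y * c.d₂ (c.d₂ (vecO t' a' b' S' c.x c.y c.z)) -
        quadr t' a' b' S' c.y * c.d₂ (vecO t' a' b' S' c.x c.y c.z)) * u := by
    simp only [opM, opE, diffOp_add, diffOp_mul, c.comm₂₁]
    simp only [diffOp]
    ring
  rw [c.opE_d₁, c.opE_d₂, c.opE_d₃] at hE
  rw [opT, hE]
  -- The derivatives of `opE u` occur equally on both sides; making them opaque keeps third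
  -- derivatives of `u` from appearing when `opE` is unfolded.
  generalize c.d₁ (c.opE t a b S r u) = e₁
  generalize c.d₂ (c.opE t a b S r u) = e₂
  generalize c.d₃ (c.opE t a b S r u) = e₃
  rw [opF_eq]
  simp only [opM, opE, diffOp, Derivation.leibniz, map_add, smul_eq_mul, c.comm₂₁, c.comm₃₁,
    c.comm₃₂]
  rw [(c.dd_vecX t).1, (c.dd_vecX t).2, (c.dd_vecY t).1, (c.dd_vecY t).2, (c.dd_vecZ t).1,
    (c.dd_vecZ t).2, (c.dd_vecO t a b S).1, (c.dd_vecO t a b S).2]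
  simp only [c.d_vecX, c.d_vecY, c.d_vecZ, c.d_vecO]
  -- From here on the derivatives of `u` are independent indeterminates, and the claim is a
  -- polynomial identity linear in them.
  generalize c.d₁ (c.d₁ u) = u₁₁
  generalize c.d₁ (c.d₂ u) = u₁₂
  generalize c.d₁ (c.d₃ u) = u₁₃
  generalize c.d₂ (c.d₂ u) = u₂₂
  generalize c.d₂ (c.d₃ u) = u₂₃
  generalize c.d₃ (c.d₃ u) = u₃₃
  generalize c.d₁ u = u₁
  generalize c.d₂ u = u₂
  generalize c.d₃ u = u₃
  generalize c.x = x
  generalize c.y = y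
  generalize c.z = z
  generalize t' = t
  generalize a' = a
  generalize b' = b
  generalize S' = S
  generalize r' = r
  linear_combination u₁₁ * symbol_xx t x y z + u₂₂ * symbol_yy t x y z + u₁₂ * symbol_xy t x y
    z + u₁₃ * symbol_xz t x y z + u₂₃ * symbol_yz t x y z + u₃₃ * symbol_zz t x y z + u₁ *
    symbol_x t a b S x y z + u₂ * symbol_y t a b S x y z + u₃ * symbol_z t a b S x y z + u *
    symbol_one t a b S r x y z

theorem opT_sub (u w : A) : c.opT t a b S r (u - w) = c.opT t a b S r u - c.opT t a b S r w := by
  simp only [opT, opE, diffOp, map_sub]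
  ring

/-- If `g` is a solution of the hypergeometric equation in the variable `x y / t`, with `R` a
multiple of its derivative, then `opT` maps `(x - y) t g` to a multiple of `R`. -/
theorem opT_hypergeometric (g R : A) (h₁ : t' * c.d₁ g = c.y * R) (h₂ : t' * c.d₂ g = c.x * R)
    (h₃ : c.d₃ g = 0) (hR : c.x * c.d₁ R = c.y * c.d₂ R)
    (hode : (t' - c.x * c.y) * (c.x * c.d₁ R) +
      ((a' - 1) * t' - (S' - 1) * (c.x * c.y)) * R - t' * ((r' - S' + 1) * g) = 0) :
    c.opT t a b S r ((c.x - c.y) * (t' * g)) = zeta t' c.x c.y c.z * R := by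
  have e₁ : c.d₁ ((c.x - c.y) * (t' * g)) = t' * g + (c.x - c.y) * (c.y * R) := by
    simp only [Derivation.leibniz, map_sub, c.d₁x, c.d₁y, Derivation.map_algebraMap, smul_eq_mul]
    linear_combination (c.x - c.y) * h₁
  have e₂ : c.d₂ ((c.x - c.y) * (t' * g)) = -(t' * g) + (c.x - c.y) * (c.x * R) := by
    simp only [Derivation.leibniz, map_sub, c.d₂x, c.d₂y, Derivation.map_algebraMap, smul_eq_mul]
    linear_combination (c.x - c.y) * h₂
  have e₃ : c.d₃ ((c.x - c.y) * (t' * g)) = 0 := by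
    simp only [Derivation.leibniz, map_sub, c.d₃x, c.d₃y, Derivation.map_algebraMap, smul_eq_mul,
      h₃]
    ring
  have e₁₁ : c.d₁ (c.d₁ ((c.x - c.y) * (t' * g))) =
      2 * (c.y * R) + (c.x - c.y) * (c.y * c.d₁ R) := by
    rw [e₁]
    simp only [Derivation.leibniz, map_sub, map_add, c.d₁x, c.d₁y, Derivation.map_algebraMap,
      smul_eq_mul]
    linear_combination h₁
  have e₂₂ : c.d₂ (c.d₂ ((c.x - c.y) * (t' * g))) =
      -(2 * (c.x * R)) + (c.x - c.y) * (c.x * c.d₂ R) := by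
    rw [e₂]
    simp only [Derivation.leibniz, map_sub, map_add, map_neg, c.d₂x, c.d₂y,
      Derivation.map_algebraMap, smul_eq_mul]
    linear_combination -h₂
  rw [opT, opE, diffOp, e₁₁, e₂₂, e₁, e₂, e₃]
  simp only [vdm, alphaX, alphaY, gammaO, zeta, cubic, quadr]
  -- The relation `hR` replaces y ∂_y R by x ∂_x R; what then remains is a multiple of the ordinary
  -- differential equation `hode`.
  linear_combination (c.x - c.y) * (c.z - c.x) * (c.z - c.y) * ((c.x - c.y) * c.x *
    ((c.y - 1) * (c.y - t')) * hR - (c.x - c.y) ^ 2 * hode)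

/-- Frobenius argument at y = 0, where `π` is reduction modulo y. On y^(k+1) u the lowest
coefficient of `opT` is -x z (z - x) t (k+1)(k+a-1) π u, so a solution divisible by y^(k+1) is
divisible by one more power. The exponent 0 is also a root of the indicial polynomial, which is why
divisibility by y must be assumed. -/
theorem opT_eq_zero_imp_dvd {B : Type*} [CommRing B] [IsDomain B] [Algebra ℂ B] (π : A →ₐ[ℂ] B)
    (hπ : ∀ u, π u = 0 → c.y ∣ u) (hy : π c.y = 0) (hx : π c.x ≠ 0) (hz : π c.z ≠ 0)
    (hzx : π c.z - π c.x ≠ 0) (ht : t ≠ 0) (ha : ∀ n : ℕ, a ≠ -n) (ha1 : a ≠ 1) (hreg : IsLeftRegular c.y) {w : A}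
    (hw : c.y ∣ w) (h : c.opT t a b S r w = 0) (n : ℕ) : c.y ^ n ∣ w := by
  -- The indicial factor at exponent k + 1: the case k = 0 needs a ≠ 1, the others need that a is
  -- not a nonpositive integer.
  have hc (k : ℕ) : t * ((k + 1) * (k + a - 1)) ≠ 0 := by
    refine mul_ne_zero ht (mul_ne_zero (by exact_mod_cast k.succ_ne_zero) fun hk => ?_)
    rcases k with _ | k
    · exact ha1 (by linear_combination hk - (Nat.cast_zero (R := ℂ)))
    · exact ha k (by push_cast at hk; linear_combination hk)
  induction n with
  | zero => simp
  | succ k ih =>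
    rcases k with _ | k
    · simpa using hw
    obtain ⟨u, rfl⟩ := ih
    have d1 (m : ℕ) (v : A) : c.d₁ (c.y ^ m * v) = c.y ^ m * c.d₁ v := by
      simp [Derivation.leibniz, Derivation.leibniz_pow, c.d₁y]
    have d3 (m : ℕ) (v : A) : c.d₃ (c.y ^ m * v) = c.y ^ m * c.d₃ v := by
      simp [Derivation.leibniz, Derivation.leibniz_pow, c.d₃y]
    -- The extra factor y avoids the exponent m - 1, which is truncated at m = 0.
    have d2 (m : ℕ) (v : A) : c.y * c.d₂ (c.y ^ m * v) = c.y ^ m * (m * v + c.y * c.d₂ v) := by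
      rcases m with _ | m
      · simp
      · simp only [Derivation.leibniz, Derivation.leibniz_pow, c.d₂y, smul_eq_mul, nsmul_eq_mul,
          Nat.add_sub_cancel]
        ring
    have d2' : c.d₂ (c.y ^ (k + 1) * u) = c.y ^ k * ((k + 1) * u + c.y * c.d₂ u) := by
      simp only [Derivation.leibniz, Derivation.leibniz_pow, c.d₂y, smul_eq_mul, nsmul_eq_mul,
          Nat.add_sub_cancel]
      push_cast
      ring
    set v := (k + 1) * u + c.y * c.d₂ u with hv
    have d22 := d2 k v
    have e : c.opT t a b S r (c.y ^ (k + 1) * u) = c.y ^ k * (vdm c.x c.y c.z *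
        (c.y * (cubic t' c.x * c.d₁ (c.d₁ u) + quadr t' a' b' S' c.x * c.d₁ u +
          r' * (c.x - c.y) * u) - (c.y - 1) * (c.y - t') * (k * v + c.y * c.d₂ v) -
          quadr t' a' b' S' c.y * v) - alphaX t' c.x c.y c.z * (c.y * c.d₁ u) -
        alphaY t' c.x c.y c.z * v - alphaZ t' c.x c.y c.z * (c.y * c.d₃ u) -
        gammaO t' a' b' S' c.x c.y c.z * (c.y * u)) := by
      rw [opT, opE, diffOp, d1, d1, d2', d3]
      -- The zero of the cubic at y = 0 compensates for one of the two powers of y lost to ∂_y², so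
      -- that y^k can be factored out.
      have hcub : cubic t' c.y = c.y * ((c.y - 1) * (c.y - t')) := by rw [cubic]; ring
      rw [hcub]
      linear_combination -(vdm c.x c.y c.z) * ((c.y - 1) * (c.y - t')) * d22
    rw [e] at h
    replace h : _ = (0 : A) := (hreg.pow k) (h.trans (mul_zero _).symm)
    replace h := congrArg π h
    simp only [hv, vdm, alphaX, alphaY, alphaZ, gammaO, cubic, quadr, map_add, map_sub, map_mul,
      map_pow, hy, AlgHom.commutes, map_one, map_natCast, map_zero, map_ofNat, map_neg] at h
    -- Modulo y only the terms with ∂_y survive: the second order term gives -t k v, `quadr` gives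
    -- -t a v, and `alphaY` gives +t v, each times x z (z - x), with v reducing to (k+1) u.
    have h' : π c.x * π c.z * (π c.z - π c.x) *
        algebraMap ℂ B (t * ((k + 1) * (k + a - 1))) * π u = 0 := by
      simp only [map_mul, map_add, map_sub, map_one, map_natCast]
      linear_combination -h
    have hu : π u = 0 := by
      refine (mul_eq_zero.mp h').resolve_left ?_
      refine mul_ne_zero (mul_ne_zero (mul_ne_zero hx hz) hzx) ?_
      rw [Ne, map_eq_zero_iff _ (algebraMap ℂ B).injective]
      exact hc k
    obtain ⟨s, rfl⟩ := hπ u hu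
    exact ⟨s, by ring⟩

end CoordDeriv

/-! ### The derivations of the Laurent polynomials and of the power series ring -/

section LaurentDerivation

theorem laurentDeriv_C_mul_T (c : ℂ) (n : ℤ) :
    laurentDeriv (LaurentPolynomial.C c * LaurentPolynomial.T n) =
      LaurentPolynomial.C (n * c) * LaurentPolynomial.T (n - 1) := by
  rw [laurentDeriv, ← LaurentPolynomial.single_eq_C_mul_T, AddMonoidAlgebra.coeff_single,
    Finsupp.sum_single_index]
  simp

theorem laurentDeriv_T (n : ℤ) : laurentDeriv (LaurentPolynomial.T n) =
    (n : ℂ) • LaurentPolynomial.T (n - 1) := by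
  have h := laurentDeriv_C_mul_T 1 n
  rwa [map_one, one_mul, mul_one, ← LaurentPolynomial.smul_eq_C_mul] at h

theorem laurentDeriv_add (f g : ℂ[T;T⁻¹]) :
    laurentDeriv (f + g) = laurentDeriv f + laurentDeriv g := by
  rw [laurentDeriv, AddMonoidAlgebra.coeff_add, Finsupp.sum_add_index']
  · rfl
  · simp
  · intro n b c
    rw [mul_add, map_add, add_mul]

theorem laurentDeriv_smul (c : ℂ) (f : ℂ[T;T⁻¹]) :
    laurentDeriv (c • f) = c • laurentDeriv f := by
  induction f using LaurentPolynomial.induction_on' with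
  | add f g hf hg => rw [smul_add, laurentDeriv_add, hf, hg, laurentDeriv_add, smul_add]
  | C_mul_T n a =>
    rw [LaurentPolynomial.smul_eq_C_mul, LaurentPolynomial.smul_eq_C_mul, ← mul_assoc, ← map_mul,
      laurentDeriv_C_mul_T, laurentDeriv_C_mul_T]
    simp only [map_mul]
    ring

theorem laurentDeriv_mul (f g : ℂ[T;T⁻¹]) :
    laurentDeriv (f * g) = f * laurentDeriv g + g * laurentDeriv f := by
  induction f using LaurentPolynomial.induction_on' with
  | add f f' hf hf' =>
    rw [add_mul, laurentDeriv_add, hf, hf', laurentDeriv_add]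
    ring
  | C_mul_T n a =>
    induction g using LaurentPolynomial.induction_on' with
    | add g g' hg hg' =>
      rw [mul_add, laurentDeriv_add, hg, hg', laurentDeriv_add]
      ring
    | C_mul_T m b =>
      have e : LaurentPolynomial.C a * LaurentPolynomial.T n *
          (LaurentPolynomial.C b * LaurentPolynomial.T m) =
          LaurentPolynomial.C (a * b) * LaurentPolynomial.T (n + m) := by
        rw [map_mul, LaurentPolynomial.T_add]
        ring
      rw [e, laurentDeriv_C_mul_T, laurentDeriv_C_mul_T, laurentDeriv_C_mul_T]
      simp only [LaurentPolynomial.T_sub, LaurentPolynomial.T_add, map_mul, Int.cast_add, map_add]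
      ring

/-- `laurentDeriv` as a derivation. -/
def laurentDerivation : Derivation ℂ ℂ[T;T⁻¹] ℂ[T;T⁻¹] :=
  Derivation.mk'
    { toFun := laurentDeriv
      map_add' := laurentDeriv_add
      map_smul' := laurentDeriv_smul } laurentDeriv_mul

theorem laurentDerivation_apply (f : ℂ[T;T⁻¹]) : laurentDerivation f = laurentDeriv f := rfl

end LaurentDerivation

section KerRing

theorem coeff_derivY (u : KerRing) (m : Fin 2 →₀ ℕ) :
    MvPowerSeries.coeff m (derivY u) = laurentDeriv (MvPowerSeries.coeff m u) := rfl

theorem coeff_smul_ker (c : ℂ) (u : KerRing) (m : Fin 2 →₀ ℕ) :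
    MvPowerSeries.coeff m (c • u) = c • MvPowerSeries.coeff m u := rfl

/-- `derivY` as a derivation. -/
def derivationY : Derivation ℂ KerRing KerRing :=
  Derivation.mk'
    { toFun := derivY
      map_add' := fun u v => by
        ext1 m
        simp only [coeff_derivY, map_add, laurentDeriv_add]
      map_smul' := fun c u => by
        ext1 m
        simp only [coeff_derivY, coeff_smul_ker, laurentDeriv_smul, RingHom.id_apply] }
    fun u v => by
      classical
      ext1 m
      have h (p : (Fin 2 →₀ ℕ) × (Fin 2 →₀ ℕ)) : laurentDeriv
          (MvPowerSeries.coeff p.1 u * MvPowerSeries.coeff p.2 v) =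
          MvPowerSeries.coeff p.1 u * laurentDeriv (MvPowerSeries.coeff p.2 v) +
          MvPowerSeries.coeff p.2 v * laurentDeriv (MvPowerSeries.coeff p.1 u) :=
        laurentDeriv_mul _ _
      simp only [LinearMap.coe_mk, AddHom.coe_mk, smul_eq_mul, map_add, coeff_derivY]
      rw [mul_comm v, MvPowerSeries.coeff_mul, MvPowerSeries.coeff_mul, MvPowerSeries.coeff_mul,
        ← laurentDerivation_apply, map_sum, ← Finset.sum_add_distrib]
      refine Finset.sum_congr rfl fun p _ => ?_
      simp only [laurentDerivation_apply, h, coeff_derivY]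
      ring

/-- The scalars are restricted to ℂ because d/dy is not linear over the Laurent polynomials, and all
three derivations must share one base. -/
def derivationX₁ : Derivation ℂ KerRing KerRing :=
  (MvPowerSeries.pderiv ℂ[T;T⁻¹] 0).restrictScalars ℂ

def derivationX₂ : Derivation ℂ KerRing KerRing :=
  (MvPowerSeries.pderiv ℂ[T;T⁻¹] 1).restrictScalars ℂ

theorem derivY_pderiv (i : Fin 2) (u : KerRing) :
    derivY (MvPowerSeries.pderiv ℂ[T;T⁻¹] i u) = MvPowerSeries.pderiv ℂ[T;T⁻¹] i (derivY u) := by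
  ext1 m
  rw [coeff_derivY, MvPowerSeries.coeff_pderiv, MvPowerSeries.coeff_pderiv, coeff_derivY]
  -- Written as the cast of a natural number, the factor is a constant that `laurentDeriv`
  -- annihilates.
  have h : ((m i : ℂ[T;T⁻¹]) + 1) = ((m i + 1 : ℕ) : ℂ[T;T⁻¹]) := by push_cast; rfl
  rw [h, laurentDeriv_mul, ← laurentDerivation_apply (Nat.cast _), Derivation.map_natCast]
  ring

theorem pderiv_pderiv_comm (i j : Fin 2) (u : KerRing) :
    MvPowerSeries.pderiv ℂ[T;T⁻¹] i (MvPowerSeries.pderiv ℂ[T;T⁻¹] j u) =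
      MvPowerSeries.pderiv ℂ[T;T⁻¹] j (MvPowerSeries.pderiv ℂ[T;T⁻¹] i u) := by
  rcases eq_or_ne i j with rfl | hij
  · rfl
  ext1 m
  simp only [MvPowerSeries.coeff_pderiv, Finsupp.add_apply, Finsupp.single_eq_of_ne hij,
    Finsupp.single_eq_of_ne hij.symm, add_right_comm m, add_zero]
  ring

theorem derivY_C (f : ℂ[T;T⁻¹]) :
    derivY (MvPowerSeries.C f) = MvPowerSeries.C (laurentDeriv f) := by
  classical
  ext1 m
  rw [coeff_derivY, MvPowerSeries.coeff_C, MvPowerSeries.coeff_C]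
  split_ifs
  · rfl
  · exact map_zero laurentDerivation

theorem derivY_X (i : Fin 2) : derivY (MvPowerSeries.X i) = 0 := by
  classical
  ext1 m
  rw [coeff_derivY, MvPowerSeries.coeff_X]
  split_ifs
  · exact laurentDerivation.map_one_eq_zero
  · exact map_zero laurentDerivation

/-- The partial derivatives of `ℂ[y, y⁻¹][[x₁, x₂]]`. -/
def kerCoord : CoordDeriv KerRing where
  d₁ := derivationX₁
  d₂ := derivationX₂
  d₃ := derivationY
  x := varX₁
  y := varX₂
  z := varY
  comm₂₁ u := pderiv_pderiv_comm 1 0 u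
  comm₃₁ u := derivY_pderiv 0 u
  comm₃₂ u := derivY_pderiv 1 u
  d₁x := MvPowerSeries.pderiv_X_self
  d₁y := MvPowerSeries.pderiv_X_of_ne (by decide)
  d₁z := MvPowerSeries.pderiv_C
  d₂x := MvPowerSeries.pderiv_X_of_ne (by decide)
  d₂y := MvPowerSeries.pderiv_X_self
  d₂z := MvPowerSeries.pderiv_C
  d₃x := derivY_X 0
  d₃y := derivY_X 1
  d₃z := by
    change derivY (MvPowerSeries.C _) = 1
    rw [derivY_C, laurentDeriv_T]
    simp

end KerRing

/-! ### Coefficients of D_x on power series in x₁, x₂ -/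

section Coefficients

variable (s : Fin 2) (m : Fin 2 →₀ ℕ)

/-- Multi-indices are written `m + single s k`, so that with `m s = 0` the operator in the variable
s moves only k and the other exponent stays fixed. -/
theorem coeff_pderiv_ker (u : KerRing) (k : ℕ) :
    MvPowerSeries.coeff (m + Finsupp.single s k) (MvPowerSeries.pderiv ℂ[T;T⁻¹] s u) =
      ((m s + k + 1 : ℂ)) • MvPowerSeries.coeff (m + Finsupp.single s (k + 1)) u := by
  rw [MvPowerSeries.coeff_pderiv, add_assoc, ← Finsupp.single_add, mul_comm,
    LaurentPolynomial.smul_eq_C_mul]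
  simp

theorem coeff_X_mul_ker_succ (u : KerRing) (k : ℕ) :
    MvPowerSeries.coeff (m + Finsupp.single s (k + 1)) (MvPowerSeries.X s * u) =
      MvPowerSeries.coeff (m + Finsupp.single s k) u := by
  rw [Finsupp.single_add, ← add_assoc, add_comm, MvPowerSeries.X,
    MvPowerSeries.coeff_add_monomial_mul, one_mul]

theorem coeff_X_mul_ker_zero (hm : m s = 0) (u : KerRing) :
    MvPowerSeries.coeff (m + Finsupp.single s 0) (MvPowerSeries.X s * u) = 0 :=
  MvPowerSeries.X_dvd_iff.mp (Dvd.intro _ rfl) _ (by simp [hm])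

theorem heunOp_pderiv (t s₁ s₂ s₃ r₁ r₂ lam : ℂ) (u : KerRing) :
    heunOp t s₁ s₂ s₃ r₁ r₂ lam (MvPowerSeries.pderiv ℂ[T;T⁻¹] s) (MvPowerSeries.X s) u =
      t • (MvPowerSeries.X s *
        MvPowerSeries.pderiv ℂ[T;T⁻¹] s (MvPowerSeries.pderiv ℂ[T;T⁻¹] s u)) -
      (1 + t) • (MvPowerSeries.X s * (MvPowerSeries.X s *
        MvPowerSeries.pderiv ℂ[T;T⁻¹] s (MvPowerSeries.pderiv ℂ[T;T⁻¹] s u))) +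
      MvPowerSeries.X s * (MvPowerSeries.X s * (MvPowerSeries.X s *
        MvPowerSeries.pderiv ℂ[T;T⁻¹] s (MvPowerSeries.pderiv ℂ[T;T⁻¹] s u))) +
      (s₁ * t) • MvPowerSeries.pderiv ℂ[T;T⁻¹] s u -
      (s₁ * (1 + t) + s₂ * t + s₃) • (MvPowerSeries.X s * MvPowerSeries.pderiv ℂ[T;T⁻¹] s u) +
      (s₁ + s₂ + s₃) •
        (MvPowerSeries.X s * (MvPowerSeries.X s * MvPowerSeries.pderiv ℂ[T;T⁻¹] s u)) +
      (r₁ * r₂) • (MvPowerSeries.X s * u) + lam • u := by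
  simp only [heunOp, heunQ, Algebra.smul_def, map_mul, map_add, map_one]
  ring

theorem coeff_heunOp_pderiv_zero (hm : m s = 0) (t s₁ s₂ s₃ r₁ r₂ lam : ℂ) (u : KerRing) :
    MvPowerSeries.coeff (m + Finsupp.single s 0)
        (heunOp t s₁ s₂ s₃ r₁ r₂ lam (MvPowerSeries.pderiv ℂ[T;T⁻¹] s) (MvPowerSeries.X s) u) =
      (t * s₁) • MvPowerSeries.coeff (m + Finsupp.single s 1) u +
        lam • MvPowerSeries.coeff (m + Finsupp.single s 0) u := by
  rw [heunOp_pderiv]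
  simp only [map_add, map_sub, coeff_smul_ker, coeff_X_mul_ker_zero s m hm, coeff_pderiv_ker, hm]
  push_cast
  module

theorem coeff_heunOp_pderiv_succ (hm : m s = 0) (t s₁ s₂ s₃ r₁ r₂ lam : ℂ) (u : KerRing) (k : ℕ) :
    MvPowerSeries.coeff (m + Finsupp.single s (k + 1))
        (heunOp t s₁ s₂ s₃ r₁ r₂ lam (MvPowerSeries.pderiv ℂ[T;T⁻¹] s) (MvPowerSeries.X s) u) =
      (t * (k + 2) * (k + 1 + s₁)) • MvPowerSeries.coeff (m + Finsupp.single s (k + 2)) u +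
        (lam - ((1 + t) * ((k + 1) * k) + (s₁ * (1 + t) + s₂ * t + s₃) * (k + 1))) •
          MvPowerSeries.coeff (m + Finsupp.single s (k + 1)) u +
        (k * (k - 1) + (s₁ + s₂ + s₃) * k + r₁ * r₂) •
          MvPowerSeries.coeff (m + Finsupp.single s k) u := by
  rw [heunOp_pderiv]
  rcases k with _ | _ | k <;>
  · simp only [map_add, map_sub, coeff_smul_ker, coeff_X_mul_ker_zero s m hm,
      coeff_X_mul_ker_succ, coeff_pderiv_ker, hm]
    simp only [zero_add, Nat.reduceAdd, add_assoc]
    push_cast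
    module

end Coefficients

/-! ### The recurrence for P_k and the equation in x₁, x₂ -/

section Recurrence

variable (t s₁ s₂ s₃ r₁ r₂ : ℂ)

theorem heunPoly_one (ht : t ≠ 0) (hs : ∀ n : ℕ, s₁ ≠ -n) :
    (t * s₁) • heunPoly t s₁ s₂ s₃ r₁ r₂ 1 = -Polynomial.X * heunPoly t s₁ s₂ s₃ r₁ r₂ 0 := by
  have hs0 : t * s₁ ≠ 0 := mul_ne_zero ht (by simpa using hs 0)
  rw [heunPoly, heunPoly, Polynomial.smul_eq_C_mul, ← mul_assoc, ← map_mul, mul_neg,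
    mul_inv_cancel₀ hs0]
  simp

theorem heunPoly_add_two (ht : t ≠ 0) (hs : ∀ n : ℕ, s₁ ≠ -n) (k : ℕ) :
    (t * (k + 2) * (k + 1 + s₁)) • heunPoly t s₁ s₂ s₃ r₁ r₂ (k + 2) =
      -Polynomial.X * heunPoly t s₁ s₂ s₃ r₁ r₂ (k + 1) +
      ((1 + t) * ((k + 1) * k) + (s₁ * (1 + t) + s₂ * t + s₃) * (k + 1)) •
        heunPoly t s₁ s₂ s₃ r₁ r₂ (k + 1) -
      (k * (k - 1) + (s₁ + s₂ + s₃) * k + r₁ * r₂) • heunPoly t s₁ s₂ s₃ r₁ r₂ k := by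
  have h2 : (k + 2 : ℂ) ≠ 0 := by exact_mod_cast (k + 1).succ_ne_zero
  have h1 : (k + 1 + s₁ : ℂ) ≠ 0 := fun h => hs (k + 1) (by
    push_cast
    linear_combination h)
  have h : t * (k + 2) * (k + 1 + s₁) ≠ 0 := mul_ne_zero (mul_ne_zero ht h2) h1
  rw [heunPoly, Polynomial.smul_eq_C_mul, ← mul_assoc, ← map_mul, mul_neg, mul_inv_cancel₀ h]
  simp only [Polynomial.smul_eq_C_mul, map_neg, map_one]
  ring

end Recurrence

section Kernel

/-- The linear map `ℂ[λ] → ℂ[y, y⁻¹]` with `P_k ↦ y^{-(k+1)}`. -/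
def kappa (P : Polynomial.Sequence ℂ) : ℂ[X] →ₗ[ℂ] ℂ[T;T⁻¹] :=
  (P.basis fun i => (Polynomial.leadingCoeff_ne_zero.mpr (P.ne_zero i)).isUnit).constr ℂ
    fun k => LaurentPolynomial.T (-(k + 1 : ℤ))

theorem kappa_apply (P : Polynomial.Sequence ℂ) (k : ℕ) :
    kappa P (P k) = LaurentPolynomial.T (-(k + 1 : ℤ)) := by
  have h := (P.basis fun i => (Polynomial.leadingCoeff_ne_zero.mpr
    (P.ne_zero i)).isUnit).constr_basis ℂ
    (fun k => (LaurentPolynomial.T (-(k + 1 : ℤ)) : ℂ[T;T⁻¹])) k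
  rwa [Polynomial.Sequence.basis_eq_self] at h

theorem coeff_kernel (P : Polynomial.Sequence ℂ) (m : Fin 2 →₀ ℕ) :
    MvPowerSeries.coeff m (kernel P) = kappa P (P (m 0) * P (m 1)) := by
  rw [kappa, Module.Basis.constr_apply]
  simp only [LaurentPolynomial.smul_eq_C_mul]
  rfl

/-- The linear functional on `ℂ[λ]` that takes the coefficient of `P_0`. -/
def epsilon (P : Polynomial.Sequence ℂ) : ℂ[X] →ₗ[ℂ] ℂ :=
  (P.basis fun i => (Polynomial.leadingCoeff_ne_zero.mpr (P.ne_zero i)).isUnit).coord 0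

theorem epsilon_apply (P : Polynomial.Sequence ℂ) (k : ℕ) :
    epsilon P (P k) = if k = 0 then 1 else 0 := by
  rw [epsilon, ← P.basis_eq_self
    (fun i => (Polynomial.leadingCoeff_ne_zero.mpr (P.ne_zero i)).isUnit) k,
    Module.Basis.coord_apply, Module.Basis.repr_self, Finsupp.single_apply]

variable (t s₁ s₂ s₃ r₁ r₂ : ℂ) (ht : t ≠ 0) (hs : ∀ n : ℕ, s₁ ≠ -n)

/-- Along the variable s the coefficients of K are κ(P_k Q) with Q fixed, and D_x combines them
exactly as the recurrence for P_k does. The result is symmetric in the two indices, so it is the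
same for both variables. -/
theorem coeff_heunOp_kernel (s : Fin 2) (lam : ℂ) (m : Fin 2 →₀ ℕ) :
    MvPowerSeries.coeff m (heunOp t s₁ s₂ s₃ r₁ r₂ lam (MvPowerSeries.pderiv ℂ[T;T⁻¹] s)
        (MvPowerSeries.X s) (kernel (heunSeq t s₁ s₂ s₃ r₁ r₂ ht hs))) =
      kappa (heunSeq t s₁ s₂ s₃ r₁ r₂ ht hs) ((Polynomial.C lam - Polynomial.X) *
        (heunPoly t s₁ s₂ s₃ r₁ r₂ (m 0) * heunPoly t s₁ s₂ s₃ r₁ r₂ (m 1))) := by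
  obtain ⟨m', k, hm', rfl⟩ : ∃ (m' : Fin 2 →₀ ℕ) (k : ℕ), m' s = 0 ∧
      m = m' + Finsupp.single s k :=
    ⟨m.erase s, m s, by simp, (Finsupp.erase_add_single s m).symm⟩
  have hcoe (i : ℕ) : (heunSeq t s₁ s₂ s₃ r₁ r₂ ht hs) i = heunPoly t s₁ s₂ s₃ r₁ r₂ i := rfl
  -- `Q` is the factor of P_i P_j that belongs to the variable other than s.
  obtain ⟨Q, hQ⟩ : ∃ Q : ℂ[X], ∀ k, heunPoly t s₁ s₂ s₃ r₁ r₂ ((m' + Finsupp.single s k) 0) *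
      heunPoly t s₁ s₂ s₃ r₁ r₂ ((m' + Finsupp.single s k) 1) =
      heunPoly t s₁ s₂ s₃ r₁ r₂ k * Q := by
    fin_cases s
    · refine ⟨heunPoly t s₁ s₂ s₃ r₁ r₂ (m' 1), fun k => ?_⟩
      simp only [Fin.zero_eta] at hm'
      simp [hm']
    · refine ⟨heunPoly t s₁ s₂ s₃ r₁ r₂ (m' 0), fun k => ?_⟩
      simp only [Fin.mk_one] at hm'
      simp [hm', mul_comm]
  rcases k with _ | k
  · rw [coeff_heunOp_pderiv_zero s m' hm']
    simp only [coeff_kernel, hcoe, hQ, ← map_smul, ← map_add]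
    congr 1
    rw [← smul_mul_assoc, heunPoly_one t s₁ s₂ s₃ r₁ r₂ ht hs, Polynomial.smul_eq_C_mul]
    ring
  · rw [coeff_heunOp_pderiv_succ s m' hm']
    simp only [coeff_kernel, hcoe, hQ, ← map_smul, ← map_add]
    congr 1
    rw [← smul_mul_assoc, heunPoly_add_two t s₁ s₂ s₃ r₁ r₂ ht hs]
    simp only [Polynomial.smul_eq_C_mul, map_sub]
    ring

theorem heunOp_kernel_sub (lam : ℂ) :
    heunOp t s₁ s₂ s₃ r₁ r₂ lam derivX₁ varX₁ (kernel (heunSeq t s₁ s₂ s₃ r₁ r₂ ht hs)) -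
      heunOp t s₁ s₂ s₃ r₁ r₂ lam derivX₂ varX₂ (kernel (heunSeq t s₁ s₂ s₃ r₁ r₂ ht hs)) = 0 := by
  rw [sub_eq_zero]
  ext1 m
  exact (coeff_heunOp_kernel t s₁ s₂ s₃ r₁ r₂ ht hs 0 lam m).trans
    (coeff_heunOp_kernel t s₁ s₂ s₃ r₁ r₂ ht hs 1 lam m).symm

end Kernel

/-! ### The conjugate operator in y -/

section Conjugate

variable (t s₁ s₂ s₃ r₁ r₂ lam : ℂ)

theorem heunConjOp_laurent (f : ℂ[T;T⁻¹]) :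
    heunConjOp t s₁ s₂ s₃ r₁ r₂ lam laurentDeriv (LaurentPolynomial.T 1) f =
      laurentDeriv (laurentDeriv (LaurentPolynomial.T 3 * f)) -
      (1 + t) • laurentDeriv (laurentDeriv (LaurentPolynomial.T 2 * f)) +
      t • laurentDeriv (laurentDeriv (LaurentPolynomial.T 1 * f)) -
      (s₁ + s₂ + s₃) • laurentDeriv (LaurentPolynomial.T 2 * f) +
      (s₁ * (1 + t) + s₂ * t + s₃) • laurentDeriv (LaurentPolynomial.T 1 * f) -
      (s₁ * t) • laurentDeriv f + (r₁ * r₂) • (LaurentPolynomial.T 1 * f) + lam • f := by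
  have h2 : (LaurentPolynomial.T 2 : ℂ[T;T⁻¹]) = LaurentPolynomial.T 1 ^ 2 := by
    rw [LaurentPolynomial.T_pow]; rfl
  have h3 : (LaurentPolynomial.T 3 : ℂ[T;T⁻¹]) = LaurentPolynomial.T 1 ^ 3 := by
    rw [LaurentPolynomial.T_pow]; rfl
  rw [h2, h3]
  generalize (LaurentPolynomial.T 1 : ℂ[T;T⁻¹]) = y
  have e₁ : y * (y - 1) * (y - algebraMap ℂ ℂ[T;T⁻¹] t) * f =
      y ^ 3 * f - (1 + t) • (y ^ 2 * f) + t • (y * f) := by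
    simp only [Algebra.smul_def, map_add, map_one]
    ring
  have e₂ : heunQ t s₁ s₂ s₃ y * f = (s₁ + s₂ + s₃) • (y ^ 2 * f) -
      (s₁ * (1 + t) + s₂ * t + s₃) • (y * f) + (s₁ * t) • f := by
    simp only [heunQ, Algebra.smul_def, map_add, map_mul, map_one]
    ring
  rw [heunConjOp, e₁, e₂]
  simp only [← laurentDerivation_apply, map_add, map_sub, Derivation.map_smul]
  simp only [Algebra.smul_def, map_add, map_mul, map_one]
  ring

/-- The relation between the r's and the s's makes the last coefficient factor. At k = 0 that term
is the constant (r₁-1)(r₂-1). -/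
theorem heunConjOp_T (hr : r₁ + r₂ = s₁ + s₂ + s₃ - 1) (k : ℤ) :
    heunConjOp t s₁ s₂ s₃ r₁ r₂ lam laurentDeriv (LaurentPolynomial.T 1)
        (LaurentPolynomial.T (-(k + 1)) : ℂ[T;T⁻¹]) =
      (t * (k + 1) * (k + s₁)) • LaurentPolynomial.T (-(k + 2)) +
      (lam - ((1 + t) * (k * (k - 1)) + (s₁ * (1 + t) + s₂ * t + s₃) * k)) •
        LaurentPolynomial.T (-(k + 1)) +
      ((k - 1 + r₁) * (k - 1 + r₂)) • LaurentPolynomial.T (-k) := by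
  rw [heunConjOp_laurent]
  simp only [← LaurentPolynomial.T_add, laurentDeriv_T, laurentDeriv_smul]
  rw [show 3 + -(k + 1) - 1 - 1 = -k by ring, show 2 + -(k + 1) - 1 - 1 = -(k + 1) by ring,
    show 1 + -(k + 1) - 1 - 1 = -(k + 2) by ring, show 2 + -(k + 1) - 1 = -k by ring,
    show 1 + -(k + 1) - 1 = -(k + 1) by ring, show -(k + 1) - 1 = -(k + 2) by ring,
    show 1 + -(k + 1) = -k by ring]
  push_cast
  obtain rfl : s₃ = r₁ + r₂ + 1 - s₁ - s₂ := by linear_combination -hr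
  module

/-- `heunConjOp` on Laurent polynomials as a linear map. -/
def heunConjLin : ℂ[T;T⁻¹] →ₗ[ℂ] ℂ[T;T⁻¹] where
  toFun := heunConjOp t s₁ s₂ s₃ r₁ r₂ lam laurentDeriv (LaurentPolynomial.T 1)
  map_add' f g := by
    simp only [heunConjOp, ← laurentDerivation_apply, mul_add, map_add]
    ring
  map_smul' c f := by
    simp only [heunConjOp, ← laurentDerivation_apply, mul_smul_comm, Derivation.map_smul,
      RingHom.id_apply]
    module

variable (ht : t ≠ 0) (hs : ∀ n : ℕ, s₁ ≠ -n)

/-- Both sides are linear in `Q`, so it suffices to take `Q = P k`. For k > 0 the action on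
y^{-(k+1)} is the recurrence for P_k; for k = 0 the recurrence has no third term, and `epsilon`
accounts for the leftover constant. -/
theorem heunConjOp_kappa (hr : r₁ + r₂ = s₁ + s₂ + s₃ - 1) (Q : ℂ[X]) :
    heunConjOp t s₁ s₂ s₃ r₁ r₂ lam laurentDeriv (LaurentPolynomial.T 1)
        (kappa (heunSeq t s₁ s₂ s₃ r₁ r₂ ht hs) Q) =
      kappa (heunSeq t s₁ s₂ s₃ r₁ r₂ ht hs) ((Polynomial.C lam - Polynomial.X) * Q) +
      ((r₁ - 1) * (r₂ - 1) * epsilon (heunSeq t s₁ s₂ s₃ r₁ r₂ ht hs) Q) •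
        (1 : ℂ[T;T⁻¹]) := by
  set P := heunSeq t s₁ s₂ s₃ r₁ r₂ ht hs with hP
  have hcoe (i : ℕ) : heunPoly t s₁ s₂ s₃ r₁ r₂ i = P i := rfl
  suffices h : heunConjLin t s₁ s₂ s₃ r₁ r₂ lam ∘ₗ kappa P =
      kappa P ∘ₗ LinearMap.mulLeft ℂ (Polynomial.C lam - Polynomial.X) +
      ((r₁ - 1) * (r₂ - 1)) • (epsilon P).smulRight (1 : ℂ[T;T⁻¹]) by
    have h' := LinearMap.congr_fun h Q
    simp only [LinearMap.comp_apply, LinearMap.add_apply, LinearMap.smul_apply,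
      LinearMap.smulRight_apply, smul_smul, LinearMap.mulLeft_apply] at h'
    exact h'
  refine (P.basis fun i => (Polynomial.leadingCoeff_ne_zero.mpr (P.ne_zero i)).isUnit).ext
    fun k => ?_
  rw [Polynomial.Sequence.basis_eq_self]
  simp only [LinearMap.comp_apply, LinearMap.add_apply, LinearMap.smul_apply,
      LinearMap.smulRight_apply, smul_smul, LinearMap.mulLeft_apply, kappa_apply, epsilon_apply]
  refine (heunConjOp_T t s₁ s₂ s₃ r₁ r₂ lam hr k).trans ?_
  rcases k with _ | k
  · have h := heunPoly_one t s₁ s₂ s₃ r₁ r₂ ht hs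
    rw [hcoe, hcoe] at h
    have e : (Polynomial.C lam - Polynomial.X) * P 0 = (t * s₁) • P 1 + lam • P 0 := by
      rw [h, Polynomial.smul_eq_C_mul]
      ring
    rw [e]
    simp only [map_add, map_smul, kappa_apply, if_true, ← LaurentPolynomial.T_zero]
    simp only [Nat.cast_zero, Nat.cast_one, Int.cast_zero, zero_add, neg_zero,
      show -(1 + 1 : ℤ) = -2 by rfl]
    module
  · have h := heunPoly_add_two t s₁ s₂ s₃ r₁ r₂ ht hs k
    rw [hcoe, hcoe, hcoe] at h
    have e : (Polynomial.C lam - Polynomial.X) * P (k + 1) =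
        (t * (k + 2) * (k + 1 + s₁)) • P (k + 2) +
        (lam - ((1 + t) * ((k + 1) * k) + (s₁ * (1 + t) + s₂ * t + s₃) * (k + 1))) • P (k + 1) +
        (k * (k - 1) + (s₁ + s₂ + s₃) * k + r₁ * r₂) • P k := by
      rw [h]
      simp only [Polynomial.smul_eq_C_mul, map_sub]
      ring
    rw [e]
    simp only [map_add, map_smul, kappa_apply, if_neg k.succ_ne_zero]
    obtain rfl : s₃ = r₁ + r₂ + 1 - s₁ - s₂ := by linear_combination -hr
    rw [show ((k + 1 : ℕ) : ℤ) + 2 = (k + 2 : ℕ) + 1 by push_cast; ring,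
      show ((k + 1 : ℕ) : ℤ) = (k : ℤ) + 1 by push_cast; ring]
    push_cast
    module

end Conjugate

/-! ### Hypergeometric coefficients and orthogonality of the P_i -/

section Hypergeometric

theorem ordinaryHypergeometricCoefficient_succ (a b c : ℂ) (hc : ∀ n : ℕ, c ≠ -n) (n : ℕ) :
    (n + 1) * (c + n) * ordinaryHypergeometricCoefficient a b c (n + 1) =
      (a + n) * (b + n) * ordinaryHypergeometricCoefficient a b c n := by
  have h1 : (n + 1 : ℂ) ≠ 0 := by exact_mod_cast n.succ_ne_zero
  have h2 : c + n ≠ 0 := fun h => hc n (by linear_combination h)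
  simp only [ordinaryHypergeometricCoefficient, ascPochhammer_succ_eval, Nat.factorial_succ,
    Nat.cast_mul, mul_inv, Nat.cast_succ]
  field_simp

theorem ordinaryHypergeometricCoefficient_sub_one (a b c : ℂ) (hc1 : c ≠ 1)
    (n : ℕ) :
    (n + 1) * ((c - 1) * ordinaryHypergeometricCoefficient (a - 1) (b - 1) (c - 1) (n + 1)) =
      (a - 1) * (b - 1) * ordinaryHypergeometricCoefficient a b c n := by
  have h1 : (n + 1 : ℂ) ≠ 0 := by exact_mod_cast n.succ_ne_zero
  have h2 : c - 1 ≠ 0 := sub_ne_zero.mpr hc1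
  have h (a : ℂ) : (ascPochhammer ℂ (n + 1)).eval (a - 1) =
      (a - 1) * (ascPochhammer ℂ n).eval a := by
    rw [ascPochhammer_succ_left]
    simp
  simp only [ordinaryHypergeometricCoefficient, h, Nat.factorial_succ, Nat.cast_mul, mul_inv,
    Nat.cast_succ]
  field_simp

end Hypergeometric

section Orthogonality

variable (t s₁ s₂ s₃ r₁ r₂ : ℂ) (ht : t ≠ 0) (hs : ∀ n : ℕ, s₁ ≠ -n)

/-- Multiplication by λ is symmetric for the bilinear form ε(P_i P_j). Applying the recurrence to
either factor expresses the values at (i, j+1) through those with second index j and j - 1. This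
determines the form from its row j = 0, and the claimed diagonal values satisfy the same relation.
-/
theorem epsilon_mul (hr : r₁ + r₂ = s₁ + s₂ + s₃ - 1) (i j : ℕ) :
    epsilon (heunSeq t s₁ s₂ s₃ r₁ r₂ ht hs)
        (heunPoly t s₁ s₂ s₃ r₁ r₂ i * heunPoly t s₁ s₂ s₃ r₁ r₂ j) =
      if i = j then ordinaryHypergeometricCoefficient r₁ r₂ s₁ i / t ^ i else 0 := by
  set P := heunSeq t s₁ s₂ s₃ r₁ r₂ ht hs with hP
  set p := heunPoly t s₁ s₂ s₃ r₁ r₂ with hp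
  set h : ℕ → ℂ := fun i => ordinaryHypergeometricCoefficient r₁ r₂ s₁ i / t ^ i with hh
  have hrec (n : ℕ) : t * (n + 1) * (n + s₁) * h (n + 1) = (n + r₁) * (n + r₂) * h n := by
    have := ordinaryHypergeometricCoefficient_succ r₁ r₂ s₁ hs n
    simp only [hh, pow_succ]
    field_simp
    linear_combination this
  have hs3 : s₃ = r₁ + r₂ + 1 - s₁ - s₂ := by linear_combination -hr
  set β : ℕ → ℂ := fun i => (1 + t) * (i * (i - 1)) + (s₁ * (1 + t) + s₂ * t + s₃) * i with hβ
  -- The value 0 at i = 0 removes the term with `p (i - 1)`, where the truncated subtraction would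
  -- give `p 0`.
  set γ : ℕ → ℂ := fun i => if i = 0 then 0 else (i - 1 + r₁) * (i - 1 + r₂) with hγ
  have hX (i : ℕ) : -Polynomial.X * p i =
      (t * (i + 1) * (i + s₁)) • p (i + 1) - β i • p i + γ i • p (i - 1) := by
    rcases i with _ | i
    · have h1 := heunPoly_one t s₁ s₂ s₃ r₁ r₂ ht hs
      simp only [← hp] at h1
      simp [hβ, hγ, ← h1]
    · have h2 := heunPoly_add_two t s₁ s₂ s₃ r₁ r₂ ht hs i
      simp only [← hp] at h2
      rw [show -Polynomial.X * p (i + 1) = (t * (i + 2) * (i + 1 + s₁)) • p (i + 2) -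
        (((1 + t) * ((i + 1) * i) + (s₁ * (1 + t) + s₂ * t + s₃) * (i + 1)) • p (i + 1) -
          (i * (i - 1) + (s₁ + s₂ + s₃) * i + r₁ * r₂) • p i) by rw [h2]; ring]
      simp only [hβ, hγ, if_neg i.succ_ne_zero, Nat.add_sub_cancel, hs3]
      push_cast
      module
  set u : ℕ → ℕ → ℂ := fun i j => epsilon P (p i * p j) with hu
  have hrel (i j : ℕ) : t * (j + 1) * (j + s₁) * u i (j + 1) =
      t * (i + 1) * (i + s₁) * u (i + 1) j - β i * u i j + γ i * u (i - 1) j + β j * u i j -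
        γ j * u i (j - 1) := by
    obtain ⟨α, hα⟩ : ∃ α : ℕ → ℂ, ∀ i, t * (i + 1) * (i + s₁) = α i := ⟨_, fun _ => rfl⟩
    simp only [hα] at hX ⊢
    have e : α j • (p i * p (j + 1)) =
        α i • (p (i + 1) * p j) - β i • (p i * p j) +
        γ i • (p (i - 1) * p j) + β j • (p i * p j) - γ j • (p i * p (j - 1)) := by
      have h1 := congrArg (· * p j) (hX i)
      have h2 := congrArg (p i * ·) (hX j)
      simp only [add_mul, sub_mul, mul_add, mul_sub, smul_mul_assoc, mul_smul_comm] at h1 h2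
      have h3 : -Polynomial.X * p i * p j = p i * (-Polynomial.X * p j) := by ring
      rw [h1, h2] at h3
      linear_combination -h3
    have e' := congrArg (epsilon P) e
    simpa only [map_add, map_sub, map_smul, smul_eq_mul] using e'
  have key (j : ℕ) : ∀ i, u i j = if i = j then h i else 0 := by
    induction j using Nat.strong_induction_on with
    | _ j ih =>
      rcases j with _ | j
      · intro i
        have e : p i * p 0 = P i := by
          rw [hp, show heunPoly t s₁ s₂ s₃ r₁ r₂ 0 = 1 by rw [heunPoly], mul_one]
          rfl
        simp only [hu]
        rw [e, epsilon_apply]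
        split_ifs with hi
        · subst hi
          simp [hh, ordinaryHypergeometricCoefficient]
        · rfl
      · intro i
        have hne : t * (j + 1) * (j + s₁) ≠ 0 := by
          refine mul_ne_zero (mul_ne_zero ht (by exact_mod_cast j.succ_ne_zero)) fun h => hs j ?_
          linear_combination h
        refine mul_left_cancel₀ hne ?_
        rw [hrel i j, ih j (by omega), ih j (by omega), ih j (by omega)]
        have hlast : γ j * u i (j - 1) = γ j * if i = j - 1 then h i else 0 := by
          rcases j with _ | j
          · simp [hγ]
          · rw [ih _ (by omega)]
        rw [hlast]
        -- Only |i - j| ≤ 1 gives nonzero terms. For i = j the β terms cancel, for i = j - 1 the two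
        -- remaining terms cancel by `hrec`, and for i = j + 1 `hrec` yields the new diagonal value.
        rcases lt_trichotomy i j with hij | rfl | hij
        · rcases Nat.lt_or_ge (i + 1) j with hij' | hij'
          · simp [show i + 1 ≠ j by omega, show i ≠ j by omega, show i - 1 ≠ j by omega,
              show i ≠ j - 1 by omega, show i ≠ j + 1 by omega]
          · obtain rfl : j = i + 1 := by omega
            have := hrec i
            simp [show i - 1 ≠ i + 1 by omega, show i ≠ i + 1 + 1 by omega, hγ]
            linear_combination this
        · rcases i with _ | i
          · simp [hγ]
          · simp
        · rcases Nat.lt_or_ge (j + 1) i with hij' | hij'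
          · simp [show i + 1 ≠ j by omega, show i ≠ j by omega, show i - 1 ≠ j by omega,
              show i ≠ j - 1 by omega, show i ≠ j + 1 by omega]
          · obtain rfl : i = j + 1 := by omega
            have := hrec j
            simp [show j + 1 + 1 ≠ j by omega, show j + 1 ≠ j - 1 by omega, hγ]
            linear_combination -this
  exact key j i

theorem heunConjOp_kernel_sub (hr : r₁ + r₂ = s₁ + s₂ + s₃ - 1) (lam : ℂ) :
    heunConjOp t s₁ s₂ s₃ r₁ r₂ lam derivY varY (kernel (heunSeq t s₁ s₂ s₃ r₁ r₂ ht hs)) -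
      heunOp t s₁ s₂ s₃ r₁ r₂ lam derivX₁ varX₁ (kernel (heunSeq t s₁ s₂ s₃ r₁ r₂ ht hs)) =
      ((r₁ - 1) * (r₂ - 1)) • hypF r₁ r₂ s₁ t := by
  ext1 m
  -- The coefficients of D_y^* do not involve x₁, x₂, so it acts on each power series coefficient
  -- separately.
  have e₁ (u : KerRing) :
      MvPowerSeries.coeff m (heunConjOp t s₁ s₂ s₃ r₁ r₂ lam derivY varY u) =
      heunConjOp t s₁ s₂ s₃ r₁ r₂ lam laurentDeriv (LaurentPolynomial.T 1)
        (MvPowerSeries.coeff m u) := by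
    have hC (f : ℂ[T;T⁻¹]) (u : KerRing) : MvPowerSeries.coeff m (MvPowerSeries.C f * u) =
      f * MvPowerSeries.coeff m u := MvPowerSeries.coeff_C_mul _ _ _
    have ha (c : ℂ) : algebraMap ℂ KerRing c = MvPowerSeries.C (algebraMap ℂ ℂ[T;T⁻¹] c) :=
      MvPowerSeries.algebraMap_apply
    have hq : heunQ t s₁ s₂ s₃ varY =
        (MvPowerSeries.C (heunQ t s₁ s₂ s₃ (LaurentPolynomial.T 1)) : KerRing) := by
      simp only [heunQ, varY, Algebra.smul_def, ha, map_add, map_mul, map_sub, map_one]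
    have hp : varY * (varY - 1) * (varY - algebraMap ℂ KerRing t) =
        (MvPowerSeries.C (LaurentPolynomial.T 1 * (LaurentPolynomial.T 1 - 1) *
          (LaurentPolynomial.T 1 - algebraMap ℂ ℂ[T;T⁻¹] t)) : KerRing) := by
      simp only [varY, ha, map_mul, map_sub, map_one]
    have hv : (r₁ * r₂) • varY + algebraMap ℂ KerRing lam =
        (MvPowerSeries.C ((r₁ * r₂) • LaurentPolynomial.T 1 + algebraMap ℂ ℂ[T;T⁻¹] lam) :
          KerRing) := by
      simp only [varY, ha, Algebra.smul_def, map_add, map_mul]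
    rw [heunConjOp, heunConjOp, hq, hp, hv]
    rw [map_add, map_sub, hC]
    simp only [coeff_derivY, hC]
  rw [map_sub, e₁, coeff_kernel, heunConjOp_kappa t s₁ s₂ s₃ r₁ r₂ lam ht hs hr]
  have e₂ := coeff_heunOp_kernel t s₁ s₂ s₃ r₁ r₂ ht hs 0 lam m
  have e₃ := epsilon_mul t s₁ s₂ s₃ r₁ r₂ ht hs hr (m 0) (m 1)
  change MvPowerSeries.coeff m (heunOp t s₁ s₂ s₃ r₁ r₂ lam derivX₁ varX₁ _) = _ at e₂
  rw [e₂]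
  change kappa _ (_ * (heunPoly t s₁ s₂ s₃ r₁ r₂ (m 0) * heunPoly t s₁ s₂ s₃ r₁ r₂ (m 1))) +
    (_ * _ * epsilon _ (heunPoly t s₁ s₂ s₃ r₁ r₂ (m 0) * heunPoly t s₁ s₂ s₃ r₁ r₂ (m 1))) • _ -
    _ = _
  rw [e₃, add_sub_cancel_left, coeff_smul_ker, mul_smul]
  congr 1
  change _ = if m 0 = m 1 then _ else _
  split_ifs
  · rw [LaurentPolynomial.smul_eq_C_mul, mul_one]
  · rw [zero_smul]

end Orthogonality

/-! ### Series in x₁x₂ and the hypergeometric equation -/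

section Diagonal

/-- The power series `∑ h n (x₁ x₂)^n`. -/
def diagSeries (h : ℕ → ℂ) : KerRing := fun m =>
  if m 0 = m 1 then LaurentPolynomial.C (h (m 0)) else 0

theorem coeff_diagSeries (h : ℕ → ℂ) (m : Fin 2 →₀ ℕ) :
    MvPowerSeries.coeff m (diagSeries h) =
      if m 0 = m 1 then LaurentPolynomial.C (h (m 0)) else 0 := rfl

theorem hypF_eq (a b c t : ℂ) :
    hypF a b c t = diagSeries fun n => ordinaryHypergeometricCoefficient a b c n / t ^ n := rfl

theorem smul_diagSeries (c : ℂ) (h : ℕ → ℂ) : c • diagSeries h = diagSeries fun n => c * h n := by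
  ext1 m
  rw [coeff_smul_ker, coeff_diagSeries, coeff_diagSeries]
  split_ifs
  · rw [LaurentPolynomial.smul_eq_C_mul, map_mul]
  · exact smul_zero c

theorem diagSeries_add (h h' : ℕ → ℂ) :
    diagSeries h + diagSeries h' = diagSeries fun n => h n + h' n := by
  ext1 m
  rw [map_add, coeff_diagSeries, coeff_diagSeries, coeff_diagSeries]
  split_ifs
  · rw [map_add]
  · exact add_zero 0

theorem diagSeries_zero : diagSeries (fun _ => 0) = 0 := by
  ext1 m
  rw [coeff_diagSeries]
  simp

theorem coeff_pderiv_ker' (s : Fin 2) (u : KerRing) (m : Fin 2 →₀ ℕ) :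
    MvPowerSeries.coeff m (MvPowerSeries.pderiv ℂ[T;T⁻¹] s u) =
      (m s + 1 : ℂ) • MvPowerSeries.coeff (m + Finsupp.single s 1) u := by
  have h := coeff_pderiv_ker s m u 0
  simpa using h

theorem pderiv_diagSeries (s s' : Fin 2) (hs : s ≠ s') (h : ℕ → ℂ) :
    MvPowerSeries.pderiv ℂ[T;T⁻¹] s (diagSeries h) =
      MvPowerSeries.X s' * diagSeries fun n => (n + 1) * h (n + 1) := by
  ext1 m
  obtain ⟨m, k, hm, rfl⟩ : ∃ (m' : Fin 2 →₀ ℕ) (k : ℕ), m' s' = 0 ∧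
      m = m' + Finsupp.single s' k :=
    ⟨m.erase s', m s', by simp, (Finsupp.erase_add_single s' m).symm⟩
  rw [coeff_pderiv_ker', coeff_diagSeries]
  rcases k with _ | k
  · rw [coeff_X_mul_ker_zero s' m hm, if_neg, smul_zero]
    fin_cases s <;> fin_cases s' <;> simp_all
  · rw [coeff_X_mul_ker_succ, coeff_diagSeries]
    fin_cases s <;> fin_cases s' <;> simp at hs hm ⊢ <;> simp only [hm]
    · split_ifs with h1 h2 h2
      · simp [LaurentPolynomial.smul_eq_C_mul]
      · omega
      · omega
      · simp
    · split_ifs with h1 h2 h2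
      · have e : m 1 = k := by omega
        simp [LaurentPolynomial.smul_eq_C_mul, e]
      · omega
      · omega
      · simp

theorem X_mul_X_mul_diagSeries (h : ℕ → ℂ) :
    varX₁ * varX₂ * diagSeries h = diagSeries fun n => if n = 0 then 0 else h (n - 1) := by
  rw [mul_assoc]
  ext1 m
  obtain ⟨i, j, rfl⟩ : ∃ i j : ℕ, m = Finsupp.single 1 j + Finsupp.single 0 i :=
    ⟨m 0, m 1, by ext s; fin_cases s <;> simp⟩
  rw [coeff_diagSeries, varX₁, varX₂]
  rcases i with _ | i
  · rw [coeff_X_mul_ker_zero _ _ (by simp)]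
    simp
  · rw [coeff_X_mul_ker_succ, add_comm]
    rcases j with _ | j
    · rw [coeff_X_mul_ker_zero _ _ (by simp)]
      simp
    · rw [coeff_X_mul_ker_succ, coeff_diagSeries]
      simp

theorem derivY_diagSeries (h : ℕ → ℂ) : derivY (diagSeries h) = 0 := by
  ext1 m
  rw [coeff_derivY, coeff_diagSeries, (MvPowerSeries.coeff m).map_zero]
  split_ifs
  · generalize h (m 0) = c
    have e := laurentDeriv_C_mul_T c 0
    simpa using e
  · exact map_zero laurentDerivation

end Diagonal

section HypergeometricEquation

variable (a b c t : ℂ)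

theorem hypF_contiguous (ht : t ≠ 0) (hc1 : c ≠ 1) (s s' : Fin 2) (hs : s ≠ s') :
    t • MvPowerSeries.pderiv ℂ[T;T⁻¹] s ((c - 1) • hypF (a - 1) (b - 1) (c - 1) t) =
      MvPowerSeries.X s' * (((a - 1) * (b - 1)) • hypF a b c t) := by
  rw [hypF_eq, hypF_eq, smul_diagSeries, smul_diagSeries, pderiv_diagSeries s s' hs,
    ← mul_smul_comm, smul_diagSeries]
  congr 2
  funext n
  have := ordinaryHypergeometricCoefficient_sub_one a b c hc1 n
  rw [pow_succ]
  field_simp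
  linear_combination this

/-- This is the hypergeometric equation of F(a-1, b-1, c-1) in the variable x₁x₂/t, multiplied by t.
The first derivative is expressed by F(a, b, c) through the contiguity relation, so only one further
derivative, in the Euler form x₁ ∂₁, appears. -/
theorem hypF_equation (ht : t ≠ 0) (hc : ∀ n : ℕ, c ≠ -n) (hc1 : c ≠ 1) :
    (algebraMap ℂ KerRing t - varX₁ * varX₂) *
        (varX₁ * derivX₁ (((a - 1) * (b - 1)) • hypF a b c t)) +
      ((algebraMap ℂ KerRing c - 1) * algebraMap ℂ KerRing t -
        (algebraMap ℂ KerRing (a + b) - 1) * (varX₁ * varX₂)) *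
        (((a - 1) * (b - 1)) • hypF a b c t) -
      algebraMap ℂ KerRing t * ((algebraMap ℂ KerRing (a * b) - algebraMap ℂ KerRing (a + b) + 1) *
        ((c - 1) • hypF (a - 1) (b - 1) (c - 1) t)) = 0 := by
  set ρ := (a - 1) * (b - 1) with hρ
  set h : ℕ → ℂ := fun n => ordinaryHypergeometricCoefficient a b c n / t ^ n with hh
  set h' : ℕ → ℂ := fun n =>
    (c - 1) * (ordinaryHypergeometricCoefficient (a - 1) (b - 1) (c - 1) n / t ^ n) with hh'
  have hrec (n : ℕ) : t * ((n + 1) * (c + n)) * h (n + 1) = (a + n) * (b + n) * h n := by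
    have := ordinaryHypergeometricCoefficient_succ a b c hc n
    simp only [hh, pow_succ]
    field_simp
    linear_combination this
  have hrec' (n : ℕ) : t * (n + 1) * h' (n + 1) = ρ * h n := by
    have := ordinaryHypergeometricCoefficient_sub_one a b c hc1 n
    simp only [hh, hh', pow_succ]
    field_simp
    linear_combination this
  have h0 : h 0 = 1 := by simp [hh, ordinaryHypergeometricCoefficient]
  have h0' : h' 0 = c - 1 := by simp [hh', ordinaryHypergeometricCoefficient]
  have hd : varX₁ * derivX₁ (diagSeries fun n => ρ * h n) = diagSeries fun n => n * (ρ * h n) := by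
    rw [derivX₁, pderiv_diagSeries 0 1 (by decide)]
    change varX₁ * (varX₂ * _) = _
    rw [← mul_assoc, X_mul_X_mul_diagSeries]
    congr 1
    funext n
    rcases n with _ | n <;> simp
  have hode : t • (diagSeries fun n => n * (ρ * h n)) +
      (-1 : ℂ) • (varX₁ * varX₂ * diagSeries fun n => n * (ρ * h n)) +
      ((c - 1) * t) • (diagSeries fun n => ρ * h n) +
      (1 - (a + b)) • (varX₁ * varX₂ * diagSeries fun n => ρ * h n) +
      (-(t * ρ)) • diagSeries h' = 0 := by
    simp only [X_mul_X_mul_diagSeries, smul_diagSeries, diagSeries_add]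
    rw [← diagSeries_zero]
    congr 1
    funext n
    clear_value h h' ρ
    rcases n with _ | n
    · simp only [h0, h0', if_true, Nat.cast_zero]
      ring
    · simp only [if_neg n.succ_ne_zero, Nat.add_sub_cancel]
      have hn : (n + 1 : ℂ) ≠ 0 := by exact_mod_cast n.succ_ne_zero
      -- The factor n + 1 is needed to substitute `hrec'`, which determines (n+1) h'(n+1).
      refine mul_left_cancel₀ hn ?_
      push_cast
      linear_combination ρ * hrec n - ρ * hrec' n - ρ * h n * hρ
  rw [hypF_eq, hypF_eq, smul_diagSeries, smul_diagSeries, hd]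
  refine Eq.trans ?_ hode
  simp only [Algebra.smul_def, hρ, map_add, map_sub, map_mul, map_neg, map_one]
  ring

end HypergeometricEquation

/-! ### The first order equation -/

section FirstOrder

instance isDomain_kerRing : IsDomain KerRing := NoZeroDivisors.to_isDomain _

theorem rescale_C_ker (a : Fin 2 → ℂ[T;T⁻¹]) (f : ℂ[T;T⁻¹]) :
    MvPowerSeries.rescale a (MvPowerSeries.C f) = MvPowerSeries.C f := by
  classical
  ext1 m
  rw [MvPowerSeries.coeff_rescale, MvPowerSeries.coeff_C]
  split_ifs with h
  · simp [h]
  · rw [mul_zero]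

/-- The evaluation at `x₂ = 0`. -/
def evalX₂ : KerRing →ₐ[ℂ] KerRing :=
  { MvPowerSeries.rescale (![1, 0] : Fin 2 → ℂ[T;T⁻¹]) with
    commutes' := fun c => by
      change MvPowerSeries.rescale _ (algebraMap ℂ KerRing c) = _
      rw [MvPowerSeries.algebraMap_apply, rescale_C_ker] }

theorem coeff_evalX₂ (u : KerRing) (m : Fin 2 →₀ ℕ) :
    MvPowerSeries.coeff m (evalX₂ u) = if m 1 = 0 then MvPowerSeries.coeff m u else 0 := by
  change MvPowerSeries.coeff m (MvPowerSeries.rescale _ u) = _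
  rw [MvPowerSeries.coeff_rescale, Finsupp.prod_fintype _ _ (by simp)]
  split_ifs with h <;> simp [h]

theorem evalX₂_eq_zero (u : KerRing) : evalX₂ u = 0 ↔ varX₂ ∣ u := by
  rw [varX₂, MvPowerSeries.X_dvd_iff]
  constructor
  · intro h m hm
    have h' := coeff_evalX₂ u m
    rw [h, if_pos hm] at h'
    simpa using h'.symm
  · intro h
    ext1 m
    rw [coeff_evalX₂]
    split_ifs with hm
    · simpa using h m hm
    · simp

theorem evalX₂_varX₁ : evalX₂ varX₁ = varX₁ := by
  classical
  ext1 m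
  rw [coeff_evalX₂, varX₁, MvPowerSeries.coeff_X]
  split_ifs with h1 h2 h2 <;> simp_all

theorem evalX₂_varX₂ : evalX₂ varX₂ = 0 := (evalX₂_eq_zero _).mpr dvd_rfl

theorem evalX₂_varY : evalX₂ varY = varY := rescale_C_ker _ _

theorem X_ker_ne_zero (s : Fin 2) : (MvPowerSeries.X s : KerRing) ≠ 0 := fun h => by
  have h' := MvPowerSeries.coeff_index_single_self_X (R := ℂ[T;T⁻¹]) s
  rw [h, map_zero] at h'
  exact zero_ne_one h'

theorem varX₁_ne_zero : varX₁ ≠ 0 := X_ker_ne_zero 0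

theorem varX₂_ne_zero : varX₂ ≠ 0 := X_ker_ne_zero 1

theorem constantCoeff_varY : MvPowerSeries.constantCoeff varY = LaurentPolynomial.T 1 :=
  MvPowerSeries.constantCoeff_C _

theorem T_one_ne_zero : (LaurentPolynomial.T 1 : ℂ[T;T⁻¹]) ≠ 0 :=
  (LaurentPolynomial.isUnit_T 1).ne_zero

theorem varY_sub_X_ne_zero (s : Fin 2) : varY - MvPowerSeries.X s ≠ 0 := fun h => by
  have h' := congrArg MvPowerSeries.constantCoeff h
  rw [map_sub, constantCoeff_varY, MvPowerSeries.constantCoeff_X, sub_zero, map_zero] at h'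
  exact T_one_ne_zero h'

theorem varY_ne_zero : varY ≠ 0 := fun h => by
  have h' := congrArg MvPowerSeries.constantCoeff h
  rw [constantCoeff_varY, map_zero] at h'
  exact T_one_ne_zero h'

theorem varX₁_sub_varX₂_ne_zero : varX₁ - varX₂ ≠ 0 := fun h => by
  have h' := congrArg evalX₂ h
  rw [map_sub, evalX₂_varX₁, evalX₂_varX₂, sub_zero, map_zero] at h'
  exact varX₁_ne_zero h'

theorem eq_zero_of_pow_varX₂_dvd (u : KerRing) (h : ∀ n, varX₂ ^ n ∣ u) : u = 0 := by
  ext1 m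
  exact MvPowerSeries.X_pow_dvd_iff.mp (h (m 1 + 1)) m (Nat.lt_succ_self _)

variable (t s₁ s₂ s₃ r₁ r₂ : ℂ) (ht : t ≠ 0) (hs : ∀ n : ℕ, s₁ ≠ -n)

/-- Since P_0 = 1, the part of K free of x₂ is the geometric series ∑ x₁^i / y^(i+1) = 1/(y - x₁).
-/
theorem evalX₂_kernel :
    evalX₂ ((varY - varX₁) * kernel (heunSeq t s₁ s₂ s₃ r₁ r₂ ht hs)) = 1 := by
  classical
  set P := heunSeq t s₁ s₂ s₃ r₁ r₂ ht hs with hP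
  have hP0 : P 0 = 1 := by
    change heunPoly t s₁ s₂ s₃ r₁ r₂ 0 = 1
    rw [heunPoly]
  ext1 m
  rw [coeff_evalX₂, MvPowerSeries.coeff_one]
  split_ifs with h1 h2 h2
  · subst h2
    rw [sub_mul, map_sub, varX₁, MvPowerSeries.coeff_zero_X_mul, sub_zero, varY,
      MvPowerSeries.coeff_C_mul, coeff_kernel]
    simp only [Finsupp.coe_zero, Pi.zero_apply, hP0, mul_one]
    rw [← hP0, kappa_apply, ← LaurentPolynomial.T_add]
    simp
  · obtain ⟨i, rfl⟩ : ∃ i, m = 0 + Finsupp.single 0 (i + 1) := by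
      refine ⟨m 0 - 1, ?_⟩
      have : m 0 ≠ 0 := fun h => h2 (by ext s; fin_cases s <;> simp [h, h1])
      ext s
      fin_cases s
      · simp
        omega
      · simp [h1]
    rw [sub_mul, map_sub, varX₁, coeff_X_mul_ker_succ, varY, MvPowerSeries.coeff_C_mul,
      coeff_kernel, coeff_kernel]
    simp only [zero_add, Finsupp.single_eq_same,
      Finsupp.single_eq_of_ne (show (1 : Fin 2) ≠ 0 by decide), hP0, mul_one, kappa_apply,
      ← LaurentPolynomial.T_add, sub_eq_zero]
    congr 1
  · subst h2
    simp at h1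
  · rfl

theorem evalX₂_hypF (a b c : ℂ) : evalX₂ (hypF a b c t) = 1 := by
  classical
  ext1 m
  rw [coeff_evalX₂, MvPowerSeries.coeff_one, hypF_eq, coeff_diagSeries]
  have h : m = 0 ↔ m 0 = 0 ∧ m 1 = 0 := by
    constructor
    · rintro rfl
      simp
    · rintro ⟨h0, h1⟩
      ext s
      fin_cases s <;> simp [h0, h1]
  by_cases h1 : m 1 = 0 <;> by_cases h0 : m 0 = 0 <;>
    simp [h, h0, h1, ordinaryHypergeometricCoefficient]

theorem heunQ_eq_quadr {A : Type*} [CommRing A] [Algebra ℂ A] (hr : r₁ + r₂ = s₁ + s₂ + s₃ - 1)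
    (x : A) : heunQ t s₁ s₂ s₃ x = quadr (algebraMap ℂ A t) (algebraMap ℂ A s₁)
      (algebraMap ℂ A s₂) (algebraMap ℂ A (r₁ + r₂)) x := by
  rw [hr]
  simp only [heunQ, quadr, Algebra.smul_def, map_add, map_sub, map_one]
  ring

/-- Both sides have the same image under `opT` and agree at x₂ = 0, so by the Frobenius argument
their difference is divisible by every power of x₂. -/
theorem opM_kernel (hr : r₁ + r₂ = s₁ + s₂ + s₃ - 1) (hs1 : s₁ ≠ 1) :
    kerCoord.opM t s₁ s₂ (r₁ + r₂) (kernel (heunSeq t s₁ s₂ s₃ r₁ r₂ ht hs)) =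
      (varX₁ - varX₂) * (algebraMap ℂ KerRing t *
        ((s₁ - 1) • hypF (r₁ - 1) (r₂ - 1) (s₁ - 1) t)) := by
  set K := kernel (heunSeq t s₁ s₂ s₃ r₁ r₂ ht hs) with hK
  set g := (s₁ - 1) • hypF (r₁ - 1) (r₂ - 1) (s₁ - 1) t with hg
  set R := ((r₁ - 1) * (r₂ - 1)) • hypF r₁ r₂ s₁ t with hR
  have hE : kerCoord.opE t s₁ s₂ (r₁ + r₂) (r₁ * r₂) K = 0 := by
    -- The parameter λ cancels in the difference of the two operators, so its value is immaterial
    -- and 0 is taken.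
    have h := heunOp_kernel_sub t s₁ s₂ s₃ r₁ r₂ ht hs 0
    rw [← h, ← hK, CoordDeriv.opE, diffOp, heunOp, heunOp,
      heunQ_eq_quadr t s₁ s₂ s₃ r₁ r₂ hr, heunQ_eq_quadr t s₁ s₂ s₃ r₁ r₂ hr]
    change cubic _ varX₁ * derivX₁ (derivX₁ K) + quadr _ _ _ _ varX₁ * derivX₁ K -
      cubic _ varX₂ * derivX₂ (derivX₂ K) - quadr _ _ _ _ varX₂ * derivX₂ K +
      algebraMap ℂ KerRing (r₁ * r₂) * (varX₁ - varX₂) * K = _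
    rw [cubic, cubic, Algebra.smul_def, Algebra.smul_def, map_zero]
    ring
  have hF : kerCoord.opF t s₁ s₂ (r₁ + r₂) (r₁ * r₂) K = R := by
    have h := heunConjOp_kernel_sub t s₁ s₂ s₃ r₁ r₂ ht hs hr 0
    rw [← hR, ← hK, heunConjOp, heunOp,
      heunQ_eq_quadr t s₁ s₂ s₃ r₁ r₂ hr, heunQ_eq_quadr t s₁ s₂ s₃ r₁ r₂ hr] at h
    rw [← h]
    change derivY (derivY (cubic _ varY * K)) - derivY (quadr _ _ _ _ varY * K) +
      algebraMap ℂ KerRing (r₁ * r₂) * varY * K - (cubic _ varX₁ * derivX₁ (derivX₁ K) +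
      quadr _ _ _ _ varX₁ * derivX₁ K + algebraMap ℂ KerRing (r₁ * r₂) * varX₁ * K) = _
    rw [cubic, cubic, Algebra.smul_def, Algebra.smul_def, map_zero, add_zero, add_zero]
  have hR' : varX₁ * derivX₁ R = varX₂ * derivX₂ R := by
    rw [hR, hypF_eq, smul_diagSeries, derivX₁, derivX₂, pderiv_diagSeries 0 1 (by decide),
      pderiv_diagSeries 1 0 (by decide)]
    change varX₁ * (varX₂ * _) = varX₂ * (varX₁ * _)
    ring
  have hT : kerCoord.opT t s₁ s₂ (r₁ + r₂) (r₁ * r₂) ((varX₁ - varX₂) *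
      (algebraMap ℂ KerRing t * g)) = zeta (algebraMap ℂ KerRing t) varX₁ varX₂ varY * R := by
    refine kerCoord.opT_hypergeometric t s₁ s₂ (r₁ + r₂) (r₁ * r₂) g R ?_ ?_ ?_ hR' ?_
    · rw [← Algebra.smul_def]
      exact hypF_contiguous r₁ r₂ s₁ t ht hs1 0 1 (by decide)
    · rw [← Algebra.smul_def]
      exact hypF_contiguous r₁ r₂ s₁ t ht hs1 1 0 (by decide)
    · rw [hg, hypF_eq, smul_diagSeries]
      exact derivY_diagSeries _
    · exact hypF_equation r₁ r₂ s₁ t ht hs hs1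
  have hMK := kerCoord.opT_opM t s₁ s₂ (r₁ + r₂) (r₁ * r₂) K
  rw [hE, hF, map_zero, map_zero, map_zero] at hMK
  rw [← sub_eq_zero]
  refine eq_zero_of_pow_varX₂_dvd _ fun n => ?_
  refine kerCoord.opT_eq_zero_imp_dvd t s₁ s₂ (r₁ + r₂) (r₁ * r₂) evalX₂
    (fun u => (evalX₂_eq_zero u).mp) evalX₂_varX₂ ?_ ?_ ?_ ht hs hs1 ?_ ?_ ?_ n
  · exact evalX₂_varX₁.symm ▸ varX₁_ne_zero
  · exact evalX₂_varY.symm ▸ varY_ne_zero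
  · change evalX₂ varY - evalX₂ varX₁ ≠ 0
    rw [evalX₂_varX₁, evalX₂_varY]
    exact varY_sub_X_ne_zero 0
  · exact mul_right_injective₀ varX₂_ne_zero
  · refine (evalX₂_eq_zero _).mp ?_
    have h₁ := evalX₂_kernel t s₁ s₂ s₃ r₁ r₂ ht hs
    rw [← hK, map_mul, map_sub, evalX₂_varX₁, evalX₂_varY] at h₁
    change evalX₂ (vecX _ varX₁ varX₂ varY * derivX₁ K + vecY _ varX₁ varX₂ varY * derivX₂ K +
      vecZ _ varX₁ varX₂ varY * derivY K + vecO _ _ _ _ varX₁ varX₂ varY * K - _) = 0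
    -- At x₂ = 0 the three derivative terms vanish and `vecO` becomes x₁ (s₁-1) t (y - x₁), which
    -- cancels the denominator of K = 1/(y - x₁).
    simp only [vecX, vecY, vecZ, vecO, numer, hg, map_add, map_sub, map_mul, map_neg,
      evalX₂_varX₁, evalX₂_varX₂, evalX₂_varY, AlgHom.commutes, evalX₂_hypF, map_one,
      Algebra.smul_def]
    linear_combination varX₁ * (algebraMap ℂ KerRing s₁ - 1) * algebraMap ℂ KerRing t * h₁
  · rw [CoordDeriv.opT_sub, hT, hMK]
    simp only [mul_zero, add_zero, zero_add]
    exact sub_self _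

theorem opL_of_opM (u v : KerRing)
    (h : kerCoord.opM t s₁ s₂ (r₁ + r₂) u = (varX₁ - varX₂) * v) :
    opL t s₁ s₂ r₁ r₂ u = toField v / (toField varX₁ * toField varX₂ *
      (toField varX₁ - toField varY) * (toField varX₂ - toField varY)) := by
  have hinj : Function.Injective toField := IsFractionRing.injective KerRing KerField
  have hne (w : KerRing) (hw : w ≠ 0) : toField w ≠ 0 := by
    rwa [Ne, map_eq_zero_iff _ hinj]
  have ha := hne _ varX₁_ne_zero
  have hb := hne _ varX₂_ne_zero
  have hab := hne _ varX₁_sub_varX₂_ne_zero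
  have hya : toField (varY - varX₁) ≠ 0 := hne _ (varY_sub_X_ne_zero 0)
  have hyb : toField (varY - varX₂) ≠ 0 := hne _ (varY_sub_X_ne_zero 1)
  rw [map_sub] at hab hya hyb
  have hba : toField varX₂ - toField varX₁ ≠ 0 := by rwa [← neg_sub, neg_ne_zero]
  have hay : toField varX₁ - toField varY ≠ 0 := by rwa [← neg_sub, neg_ne_zero]
  have hby : toField varX₂ - toField varY ≠ 0 := by rwa [← neg_sub, neg_ne_zero]
  have h' := congrArg toField h
  change toField (vecX _ varX₁ varX₂ varY * derivX₁ u + vecY _ varX₁ varX₂ varY * derivX₂ u +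
      vecZ _ varX₁ varX₂ varY * derivY u + vecO _ _ _ _ varX₁ varX₂ varY * u) = _ at h'
  simp only [vecX, vecY, vecZ, vecO, numer, map_add, map_sub, map_mul, map_neg, map_one,
    map_ofNat] at h'
  simp only [opL, map_add, map_sub, map_mul, map_one, map_ofNat]
  generalize toField varX₁ = x at *
  generalize toField varX₂ = y at *
  generalize toField varY = z at *
  generalize toField (derivX₁ u) = u₁ at *
  generalize toField (derivX₂ u) = u₂ at *
  generalize toField (derivY u) = u₃ at *
  generalize toField u = u₀ at *
  generalize toField v = v₀ at *
  -- Fixing the signs leaves only three distinct differences in the denominators.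
  have e₁ : y - x = -(x - y) := by ring
  have e₂ : z - x = -(x - z) := by ring
  have e₃ : z - y = -(y - z) := by ring
  rw [e₁, e₂, e₃]
  field_simp
  linear_combination h'

end FirstOrder

end

theorem theorem5p3p2 (t s₁ s₂ s₃ r₁ r₂ : ℂ) (ht0 : t ≠ 0) (ht1 : t ≠ 1)
    (hs : ∀ n : ℕ, s₁ ≠ -n) (hr : r₁ + r₂ = s₁ + s₂ + s₃ - 1)
    (K : KerRing) (hK : K = kernel (heunSeq t s₁ s₂ s₃ r₁ r₂ ht0 hs)) :
    (∀ lam : ℂ,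
      heunOp t s₁ s₂ s₃ r₁ r₂ lam derivX₁ varX₁ K -
          heunOp t s₁ s₂ s₃ r₁ r₂ lam derivX₂ varX₂ K = 0) ∧
    (∀ lam : ℂ,
      heunConjOp t s₁ s₂ s₃ r₁ r₂ lam derivY varY K -
          heunOp t s₁ s₂ s₃ r₁ r₂ lam derivX₁ varX₁ K =
        ((r₁ - 1) * (r₂ - 1)) • hypF r₁ r₂ s₁ t) ∧
    (s₁ ≠ 1 →
      opL t s₁ s₂ r₁ r₂ K =
        toField (algebraMap ℂ KerRing ((s₁ - 1) * t)) /
            (toField varX₁ * toField varX₂ * (toField varX₁ - toField varY) *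
              (toField varX₂ - toField varY)) *
          toField (hypF (r₁ - 1) (r₂ - 1) (s₁ - 1) t)) := by
  subst hK
  refine ⟨heunOp_kernel_sub t s₁ s₂ s₃ r₁ r₂ ht0 hs,
    heunConjOp_kernel_sub t s₁ s₂ s₃ r₁ r₂ ht0 hs hr, fun hs1 => ?_⟩
  rw [opL_of_opM t s₁ s₂ r₁ r₂ _ _ (opM_kernel t s₁ s₂ s₃ r₁ r₂ ht0 hs hr hs1),
    Algebra.smul_def, ← mul_assoc, mul_comm (algebraMap ℂ KerRing t), ← map_mul, map_mul toField,
    div_mul_eq_mul_div]
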